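/- Let $n\ge 1$ and let $X=\{X_t\}_{t\ge 0}$ be a Lévy process on $\mathbb{R}^n$ (that is, $X_0=0$ a.s., càdlàg paths, stationary and independent increments), with characteristic exponent $\Psi:\mathbb{R}^n\to\mathbb{C}$, the continuous function with $\mathbf{E}\,e^{i\langle \xi,X_t\rangle}=e^{-t\Psi(\xi)}$ for all $t\ge 0$ and $\xi\in\mathbb{R}^n$. Assume that 1. $\displaystyle\liminf_{\|\xi\|\to\infty}\frac{\log \operatorname{Re}\Psi(\xi)}{\log\|\xi\|}=\beta_\infty$ for some $\beta_\infty\in(0,2)$ (with $\log 0=-\infty$); 2. $\displaystyle\int_{\{\|\xi\|\le 1\}}\frac{|\Psi(\xi)|}{\|\xi\|^{n+\beta_0}}\,d\xi<\infty$ for some $\beta_0\in(0,1)$. Then for every $t>0$ the law of $X_t$ has a density $p_t$ with respect to Lebesgue measure on $\mathbb{R}^n$. Moreover, for every $T>0$ and $\kappa\in(0,\beta_0/2)$ there is a constant $C>0$, depending only on $T$, $\kappa$, $\beta_\infty$, $\beta_0$ and the law of the process, such that for all $\theta,\tau,\omega\in(0,1)$, all $t\in(0,T)$, all $h\in\mathbb{R}^n$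 with $\|h\|\le 1$ and all $\varepsilon>0$, $$\int_{\mathbb{R}^n}|p_t(x+h)-p_t(x)|\,dx\le C\left(\frac{\|h\|^{\theta}}{t^{\frac{\theta+n}{\beta_\infty}+\kappa}}\right)^{\frac{\tau\beta_0}{n+\beta_0}},$$ $$\int_{\mathbb{R}^n}|p_{t+\varepsilon}(x)-p_t(x)|\,dx\le C\left(\frac{\varepsilon^{\theta}}{t^{\frac{2\theta+n}{\beta_\infty}+\kappa}}\right)^{\frac{\omega\beta_0}{n+\beta_0}}.$$ -/

import Mathlib

open MeasureTheory ProbabilityTheory Filter Topology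
open scoped NNReal ENNReal

/-- A path indexed by `[0, ∞)` is càdlàg: right-continuous, with left limits. -/
def IsCadlagPath {E : Type*} [TopologicalSpace E] (f : ℝ≥0 → E) : Prop :=
  (∀ t, ContinuousWithinAt f (Set.Ici t) t) ∧ ∀ t, 0 < t → ∃ l, Tendsto f (𝓝[<] t) (𝓝 l)

/-- `X` is a Lévy process on `ℝⁿ` under the measure `P`. -/
structure IsLevyProcess {Ω : Type*} [MeasurableSpace Ω] {n : ℕ} (P : Measure Ω)
    (X : ℝ≥0 → Ω → EuclideanSpace ℝ (Fin n)) : Prop where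
  measurable : ∀ t, Measurable (X t)
  zero : ∀ᵐ ω ∂P, X 0 ω = 0
  cadlag : ∀ᵐ ω ∂P, IsCadlagPath fun t => X t ω
  indep_increments : HasIndepIncrements X P
  stationary_increments : ∀ s t, IdentDistrib (X (s + t) - X s) (X t - X 0) P P

/-- `Ψ` is the characteristic exponent of `X`: it is continuous and
`E exp(i⟨ξ, X_t⟩) = exp(-t Ψ(ξ))` for all `t ≥ 0` and all `ξ`. -/
structure IsCharExponent {Ω : Type*} [MeasurableSpace Ω] {n : ℕ} (P : Measure Ω)
    (X : ℝ≥0 → Ω → EuclideanSpace ℝ (Fin n)) (Ψ : EuclideanSpace ℝ (Fin n) → ℂ) : Prop where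
  continuous : Continuous Ψ
  charFun_eq : ∀ (t : ℝ≥0) (ξ : EuclideanSpace ℝ (Fin n)),
    charFun (P.map (X t)) ξ = Complex.exp (-((t : ℝ) : ℂ) * Ψ ξ)

/-- The lower growth index of `Re Ψ` at infinity,
`liminf_{‖ξ‖ → ∞} log (Re Ψ(ξ)) / log ‖ξ‖`, computed in `[-∞, ∞]` with `log 0 = -∞`. -/
noncomputable def lowerIndexAtInfinity {n : ℕ} (Ψ : EuclideanSpace ℝ (Fin n) → ℂ) : EReal :=
  liminf (fun ξ => ENNReal.log (ENNReal.ofReal (Ψ ξ).re) / ((Real.log ‖ξ‖ : ℝ) : EReal))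
    (Bornology.cobounded (EuclideanSpace ℝ (Fin n)))

/-- For every `t > 0`, `p t` is a density of the law of `X t` with respect to Lebesgue measure. -/
def IsTransitionDensity {Ω : Type*} [MeasurableSpace Ω] {n : ℕ} (P : Measure Ω)
    (X : ℝ≥0 → Ω → EuclideanSpace ℝ (Fin n)) (p : ℝ≥0 → EuclideanSpace ℝ (Fin n) → ℝ) : Prop :=
  ∀ t, 0 < t → Measurable (p t) ∧ (∀ x, 0 ≤ p t x) ∧
    P.map (X t) = volume.withDensity fun x => ENNReal.ofReal (p t x)

/-!
Let `μ` be the law of `X_t`, and let `ν` be its translate by `-h` or the law of `X_{t+ε}`. Then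
`charFun ν = exp (-z) * charFun μ` with `0 ≤ Re z` and `‖z‖` at most `‖h‖ ‖ξ‖`, respectively
`M ε (1 + ‖ξ‖) ^ 2`, so that `‖charFun ν - charFun μ‖ ≤ 2 ‖z‖ ^ θ ‖charFun μ‖` for `0 ≤ θ ≤ 1`.
The growth of `Re Ψ` at infinity bounds the weighted `L¹` norm of `charFun μ` by a negative power
of `t`, and Fourier inversion turns this into a bound by a multiple of
`A = ‖h‖ ^ θ / t ^ ((θ + n) / β + κ)`, respectively `A = ε ^ θ / t ^ ((2 θ + n) / β + κ)`, for the
supremum of the difference of the densities. The integrability of `‖Ψ ξ‖ / ‖ξ‖ ^ (n + β₀)` at the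
origin gives both laws tails of order `R ^ (-β₀)`. Splitting the `L¹` norm of the difference at
`R = A ^ (-1 / (n + β₀))`, where `R ^ n A = R ^ (-β₀)`, bounds it by a multiple of
`A ^ (β₀ / (n + β₀))`.
-/

section FourierInversion

open scoped FourierTransform SchwartzMap ContDiff RealInnerProductSpace

variable {E : Type*} [NormedAddCommGroup E] [NormedSpace ℝ E] [FiniteDimensional ℝ E]
  [MeasurableSpace E] [BorelSpace E]

theorem locallyIntegrable_rnDeriv_mul_continuous {μ ν : Measure E} [IsLocallyFiniteMeasure ν]
    (hμν : μ ≤ ν) {q : E → ℝ} (hq : Continuous q) :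
    LocallyIntegrable (fun x => (μ.rnDeriv ν x).toReal * q x) ν := by
  refine hq.locallyIntegrable.mono
    ((Measure.measurable_rnDeriv _ _).ennreal_toReal.mul hq.measurable).aestronglyMeasurable ?_
  filter_upwards [Measure.rnDeriv_le_one_of_le hμν] with x hx
  rw [norm_mul, Real.norm_of_nonneg ENNReal.toReal_nonneg]
  exact mul_le_of_le_one_left (norm_nonneg _)
    (by simpa using ENNReal.toReal_mono ENNReal.one_ne_top hx)

theorem eq_withDensity_of_integral_contDiff_eq {μ ν : Measure E} [IsFiniteMeasure μ]
    [IsLocallyFiniteMeasure ν] {q : E → ℝ} (hq : Continuous q)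
    (h : ∀ u : E → ℝ, ContDiff ℝ ∞ u → HasCompactSupport u →
      ∫ x, u x ∂μ = ∫ x, u x * q x ∂ν) :
    μ = ν.withDensity fun x => ENNReal.ofReal (q x) := by
  set ρ := μ + ν
  have hμ : μ ≤ ρ := Measure.le_add_right le_rfl
  have hν : ν ≤ ρ := Measure.le_add_left le_rfl
  have hμρ := Measure.absolutelyContinuous_of_le hμ
  have hνρ := Measure.absolutelyContinuous_of_le hν
  have hρ : IsLocallyFiniteMeasure ρ := ⟨fun x => by
    obtain ⟨s, hs, hsν⟩ := ν.finiteAt_nhds x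
    exact ⟨s, hs, ENNReal.add_lt_top.2 ⟨measure_lt_top μ s, hsν⟩⟩⟩
  have hreal : ∀ᵐ x ∂ρ, (μ.rnDeriv ρ x).toReal = (ν.rnDeriv ρ x).toReal * q x := by
    refine ae_eq_of_integral_contDiff_smul_eq Measure.integrable_toReal_rnDeriv.locallyIntegrable
      (locallyIntegrable_rnDeriv_mul_continuous hν hq) fun u hu hsupp => ?_
    calc ∫ x, u x • (μ.rnDeriv ρ x).toReal ∂ρ = ∫ x, (μ.rnDeriv ρ x).toReal • u x ∂ρ := by
          simp only [smul_eq_mul, mul_comm]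
      _ = ∫ x, u x * q x ∂ν := by rw [integral_rnDeriv_smul hμρ, h u hu hsupp]
      _ = ∫ x, (ν.rnDeriv ρ x).toReal • (u x * q x) ∂ρ := (integral_rnDeriv_smul hνρ).symm
      _ = ∫ x, u x • ((ν.rnDeriv ρ x).toReal * q x) ∂ρ := by
          simp only [smul_eq_mul, mul_left_comm]
  have hderiv : μ.rnDeriv ρ =ᵐ[ρ] ν.rnDeriv ρ * fun x => ENNReal.ofReal (q x) := by
    filter_upwards [hreal, Measure.rnDeriv_ne_top μ ρ, Measure.rnDeriv_ne_top ν ρ] with x hx h₁ h₂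
    rw [Pi.mul_apply, ← ENNReal.ofReal_toReal h₁, hx, ENNReal.ofReal_mul ENNReal.toReal_nonneg,
      ENNReal.ofReal_toReal h₂]
  calc μ = ρ.withDensity (μ.rnDeriv ρ) := (Measure.withDensity_rnDeriv_eq _ _ hμρ).symm
    _ = ρ.withDensity (ν.rnDeriv ρ * fun x => ENNReal.ofReal (q x)) := withDensity_congr_ae hderiv
    _ = (ρ.withDensity (ν.rnDeriv ρ)).withDensity fun x => ENNReal.ofReal (q x) :=
        withDensity_mul _ (Measure.measurable_rnDeriv _ _) hq.measurable.ennreal_ofReal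
    _ = ν.withDensity fun x => ENNReal.ofReal (q x) := by
        rw [Measure.withDensity_rnDeriv_eq _ _ hνρ]

variable {V : Type*} [NormedAddCommGroup V] [InnerProductSpace ℝ V] [FiniteDimensional ℝ V]
  [MeasurableSpace V] [BorelSpace V]

/-- The function `x ↦ (2π)⁻ⁿ ∫ exp (-i⟪ξ, x⟫) φ ξ dξ` whose characteristic function is `φ`, for
integrable `φ`. It is written through Mathlib's inverse Fourier transform, which has the phase
`exp (2πi⟪ξ, x⟫)`; the dilation by `-2π` accounts for the difference. -/
noncomputable def charFunInv (φ : V → ℂ) : V → ℂ :=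
  𝓕⁻ fun ξ => φ (-(2 * Real.pi) • ξ)

theorem integrable_comp_neg_two_pi_smul {φ : V → ℂ} (hφ : Integrable φ) :
    Integrable fun ξ : V => φ (-(2 * Real.pi) • ξ) :=
  hφ.comp_smul (by simp [Real.pi_ne_zero])

theorem continuous_charFunInv {φ : V → ℂ} (hφ : Integrable φ) : Continuous (charFunInv φ) :=
  VectorFourier.fourierIntegral_continuous Real.continuous_fourierChar
    (continuous_inner.neg : Continuous fun p : V × V => (-innerₗ V) p.1 p.2)
    (integrable_comp_neg_two_pi_smul hφ)

theorem charFunInv_sub {φ ψ : V → ℂ} (hφ : Integrable φ) (hψ : Integrable ψ) (x : V) :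
    charFunInv (φ - ψ) x = charFunInv φ x - charFunInv ψ x := by
  have hint {φ : V → ℂ} (hφ : Integrable φ) :
      Integrable fun ξ => 𝐞 ⟪ξ, x⟫ • φ (-(2 * Real.pi) • ξ) := by
    simpa using (Real.fourierIntegral_convergent_iff (-x)).2 (integrable_comp_neg_two_pi_smul hφ)
  simp only [charFunInv, Real.fourierInv_eq, Pi.sub_apply, smul_sub]
  exact integral_sub (hint hφ) (hint hψ)

theorem norm_charFunInv_le (φ : V → ℂ) (x : V) : ‖charFunInv φ x‖ ≤ ∫ ξ, ‖φ ξ‖ := by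
  have hscale : |((-(2 * Real.pi)) ^ Module.finrank ℝ V)⁻¹| ≤ 1 := by
    rw [abs_inv, abs_pow, abs_neg, abs_of_pos (by positivity)]
    exact inv_le_one_of_one_le₀ (one_le_pow₀ (by linarith [Real.pi_gt_three]))
  calc ‖charFunInv φ x‖ ≤ ∫ ξ : V, ‖φ (-(2 * Real.pi) • ξ)‖ :=
        VectorFourier.norm_fourierIntegral_le_integral_norm _ _ _ _ _
    _ = |((-(2 * Real.pi)) ^ Module.finrank ℝ V)⁻¹| • ∫ ξ, ‖φ ξ‖ :=
        Measure.integral_comp_smul volume (fun ξ => ‖φ ξ‖) _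
    _ ≤ ∫ ξ, ‖φ ξ‖ := mul_le_of_le_one_left (integral_nonneg fun ξ => norm_nonneg _) hscale

theorem integral_schwartz_eq_integral_mul_charFunInv (μ : Measure V) [IsFiniteMeasure μ]
    (hμ : Integrable (charFun μ)) (g : 𝓢(V, ℂ)) :
    ∫ x, g x ∂μ = ∫ x, g x * charFunInv (charFun μ) x := by
  have hflip : (innerₗ V).flip = innerₗ V := by ext x y; simp
  have hnflip : (-innerₗ V).flip = -innerₗ V := by ext x y; simp [real_inner_comm]
  have hg : VectorFourier.fourierIntegral Real.fourierChar volume (innerₗ V)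
      (𝓕⁻ g : 𝓢(V, ℂ)) = g := by
    change 𝓕 ((𝓕⁻ g : 𝓢(V, ℂ)) : V → ℂ) = g
    rw [← SchwartzMap.fourier_coe, FourierTransform.fourier_fourierInv_eq]
  have hginv : ((𝓕⁻ g : 𝓢(V, ℂ)) : V → ℂ) =
      VectorFourier.fourierIntegral Real.fourierChar volume (-innerₗ V) g := by
    rw [SchwartzMap.fourierInv_coe]; rfl
  have hcharFun : VectorFourier.fourierIntegral Real.fourierChar μ (innerₗ V) (fun _ => (1 : ℂ)) =
      fun ξ : V => charFun μ (-(2 * Real.pi) • ξ) := by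
    ext ξ
    have hpi : -(2 * Real.pi)⁻¹ * -(2 * Real.pi) = 1 := by field_simp
    rw [charFun_eq_fourierIntegral', smul_smul, hpi, one_smul]
    rfl
  have hfubini := VectorFourier.integral_fourierIntegral_smul_eq_flip (μ := volume) (ν := μ)
    (L := innerₗ V) (e := Real.fourierChar) (f := (𝓕⁻ g : 𝓢(V, ℂ))) (g := fun _ => (1 : ℂ))
    Real.continuous_fourierChar continuous_inner (𝓕⁻ g : 𝓢(V, ℂ)).integrable (integrable_const _)
  have hfubini_inv := VectorFourier.integral_fourierIntegral_smul_eq_flip (μ := volume)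
    (ν := volume) (L := -innerₗ V) (e := Real.fourierChar) (f := g)
    (g := fun ξ : V => charFun μ (-(2 * Real.pi) • ξ)) Real.continuous_fourierChar
    (continuous_inner.neg : Continuous fun p : V × V => (-innerₗ V) p.1 p.2) g.integrable
    (integrable_comp_neg_two_pi_smul hμ)
  rw [hflip, hg, hcharFun] at hfubini
  rw [hnflip, ← hginv] at hfubini_inv
  simp only [smul_eq_mul, mul_one] at hfubini hfubini_inv
  rw [hfubini, hfubini_inv]
  rfl

theorem eq_withDensity_of_integrable_charFun {μ : Measure V} [IsFiniteMeasure μ]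
    (hμ : Integrable (charFun μ)) :
    μ = volume.withDensity fun x => ENNReal.ofReal (charFunInv (charFun μ) x).re := by
  have hcont := continuous_charFunInv hμ
  refine eq_withDensity_of_integral_contDiff_eq (Complex.continuous_re.comp hcont)
    fun u hu hsupp => ?_
  have hu' : ContDiff ℝ ∞ fun x => (u x : ℂ) := Complex.ofRealCLM.contDiff.comp hu
  have hsupp' : HasCompactSupport fun x => (u x : ℂ) :=
    hsupp.comp_left (g := fun r : ℝ => (r : ℂ)) Complex.ofReal_zero
  have hmul : Integrable fun x => (u x : ℂ) * charFunInv (charFun μ) x :=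
    (hu'.continuous.mul hcont).integrable_of_hasCompactSupport hsupp'.mul_right
  have hSchwartz := integral_schwartz_eq_integral_mul_charFunInv μ hμ (hsupp'.toSchwartzMap hu')
  simp only [HasCompactSupport.toSchwartzMap_toFun] at hSchwartz
  rw [integral_complex_ofReal] at hSchwartz
  calc ∫ x, u x ∂μ = (∫ x, (u x : ℂ) * charFunInv (charFun μ) x).re := by
        rw [← hSchwartz]; rfl
    _ = ∫ x, u x * (charFunInv (charFun μ) x).re := by
        rw [← RCLike.re_eq_complex_re, ← integral_re hmul]
        simp

end FourierInversion

section LebesgueDensity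

variable {V : Type*} [NormedAddCommGroup V] [InnerProductSpace ℝ V] [FiniteDimensional ℝ V]
  [MeasurableSpace V] [BorelSpace V]

/-- `f` is a density of `μ` with respect to Lebesgue measure. As for `IsTransitionDensity`, it is
real-valued and nonnegative everywhere. -/
structure IsLebesgueDensity (μ : Measure V) (f : V → ℝ) : Prop where
  measurable : Measurable f
  nonneg : ∀ x, 0 ≤ f x
  eq_withDensity : μ = volume.withDensity fun x => ENNReal.ofReal (f x)

namespace IsLebesgueDensity

variable {μ ν : Measure V} {f g : V → ℝ}

theorem integrable [IsFiniteMeasure μ] (hf : IsLebesgueDensity μ f) : Integrable f := by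
  obtain ⟨hmeas, hnonneg, hμ⟩ := hf
  refine ⟨hmeas.aestronglyMeasurable, ?_⟩
  rw [hasFiniteIntegral_iff_ofReal (.of_forall hnonneg), ← setLIntegral_univ,
    ← withDensity_apply _ MeasurableSet.univ, ← hμ]
  exact measure_lt_top μ Set.univ

theorem setIntegral_eq (hf : IsLebesgueDensity μ f) {s : Set V} (hs : MeasurableSet s) :
    ∫ x in s, f x = μ.real s := by
  obtain ⟨hmeas, hnonneg, hμ⟩ := hf
  rw [integral_eq_lintegral_of_nonneg_ae (.of_forall hnonneg) hmeas.aestronglyMeasurable, hμ,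
    Measure.real, withDensity_apply _ hs]

theorem of_integrable_charFun [IsFiniteMeasure μ] (hμ : Integrable (charFun μ)) :
    IsLebesgueDensity μ fun x => max (charFunInv (charFun μ) x).re 0 :=
  ⟨(Complex.measurable_re.comp (continuous_charFunInv hμ).measurable).max measurable_const,
    fun _ => le_max_right _ _, by
      simpa [ENNReal.ofReal_max] using eq_withDensity_of_integrable_charFun hμ⟩

theorem ae_eq [IsFiniteMeasure μ] (hf : IsLebesgueDensity μ f) (hg : IsLebesgueDensity μ g) :
    f =ᵐ[volume] g := by
  refine hf.integrable.ae_eq_of_forall_setIntegral_eq f g hg.integrable fun s hs _ => ?_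
  rw [hf.setIntegral_eq hs, hg.setIntegral_eq hs]

theorem comp_add_right (hf : IsLebesgueDensity μ f) (h : V) :
    IsLebesgueDensity (μ.map (· + -h)) fun x => f (x + h) := by
  obtain ⟨hmeas, hnonneg, hμ⟩ := hf
  refine ⟨hmeas.comp (measurable_add_const h), fun x => hnonneg _, ?_⟩
  ext s hs
  have hpre : (· + h) ⁻¹' ((· + -h) ⁻¹' s) = s := by ext x; simp
  rw [Measure.map_apply (measurable_add_const _) hs, withDensity_apply _ hs, hμ,
    withDensity_apply _ (measurable_add_const _ hs),
    ← (measurePreserving_add_right volume h).setLIntegral_comp_preimage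
      (measurable_add_const _ hs) hmeas.ennreal_ofReal, hpre]

theorem ae_abs_sub_le [IsFiniteMeasure μ] [IsFiniteMeasure ν] (hμ : Integrable (charFun μ))
    (hν : Integrable (charFun ν)) (hf : IsLebesgueDensity μ f) (hg : IsLebesgueDensity ν g) :
    ∀ᵐ x, |f x - g x| ≤ ∫ ξ, ‖charFun μ ξ - charFun ν ξ‖ := by
  filter_upwards [hf.ae_eq (of_integrable_charFun hμ), hg.ae_eq (of_integrable_charFun hν)]
    with x hfx hgx
  rw [hfx, hgx]
  calc |max (charFunInv (charFun μ) x).re 0 - max (charFunInv (charFun ν) x).re 0|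
      ≤ |(charFunInv (charFun μ) x).re - (charFunInv (charFun ν) x).re| :=
        abs_max_sub_max_le_abs _ _ _
    _ ≤ ‖charFunInv (charFun μ) x - charFunInv (charFun ν) x‖ := by
        rw [← Complex.sub_re]; exact Complex.abs_re_le_norm _
    _ = ‖charFunInv (charFun μ - charFun ν) x‖ := by rw [charFunInv_sub hμ hν]
    _ ≤ ∫ ξ, ‖charFun μ ξ - charFun ν ξ‖ := norm_charFunInv_le _ _

theorem setIntegral_abs_sub_le [IsFiniteMeasure μ] [IsFiniteMeasure ν]
    (hf : IsLebesgueDensity μ f) (hg : IsLebesgueDensity ν g) {s : Set V} (hs : MeasurableSet s) :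
    ∫ x in s, |f x - g x| ≤ μ.real s + ν.real s := by
  have hfi : IntegrableOn f s := hf.integrable.integrableOn
  have hgi : IntegrableOn g s := hg.integrable.integrableOn
  calc ∫ x in s, |f x - g x| ≤ ∫ x in s, (f x + g x) :=
        integral_mono (hfi.sub hgi).abs (hfi.add hgi) fun x =>
          abs_sub_le_of_nonneg_of_le (hf.nonneg x) (le_add_of_nonneg_right (hg.nonneg x))
            (hg.nonneg x) (le_add_of_nonneg_left (hf.nonneg x))
    _ = μ.real s + ν.real s := by
        rw [integral_add hfi hgi, hf.setIntegral_eq hs, hg.setIntegral_eq hs]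

theorem integral_abs_sub_le_two [IsProbabilityMeasure μ] [IsProbabilityMeasure ν]
    (hf : IsLebesgueDensity μ f) (hg : IsLebesgueDensity ν g) : ∫ x, |f x - g x| ≤ 2 := by
  have h := setIntegral_abs_sub_le hf hg MeasurableSet.univ
  rw [setIntegral_univ, probReal_univ, probReal_univ] at h
  linarith

end IsLebesgueDensity

end LebesgueDensity

section ComplexExponential

theorem norm_one_sub_exp_neg_le {z : ℂ} (hz : 0 ≤ z.re) : ‖1 - Complex.exp (-z)‖ ≤ ‖z‖ := by
  have h := (convex_halfSpace_re_le 0).norm_image_sub_le_of_norm_hasDerivWithin_le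
    (f := Complex.exp) (f' := Complex.exp) (C := 1) (x := -z) (y := 0)
    (fun x _ => (Complex.hasDerivAt_exp x).hasDerivWithinAt)
    (fun x hx => by rw [Complex.norm_exp]; exact Real.exp_le_one_iff.2 hx)
    (by simpa using hz) (by simp)
  simpa using h

theorem norm_one_sub_exp_neg_le_two_mul_rpow {z : ℂ} (hz : 0 ≤ z.re) {θ : ℝ}
    (hθ : θ ∈ Set.Icc 0 1) : ‖1 - Complex.exp (-z)‖ ≤ 2 * ‖z‖ ^ θ := by
  rcases le_total ‖z‖ 1 with hle | hge
  · have hpow : ‖z‖ ≤ ‖z‖ ^ θ := Real.self_le_rpow_of_le_one (norm_nonneg z) hle hθ.2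
    linarith [norm_one_sub_exp_neg_le hz, norm_nonneg z]
  · have hexp : ‖Complex.exp (-z)‖ ≤ 1 := by
      rw [Complex.norm_exp]
      exact Real.exp_le_one_iff.2 (by simpa using hz)
    have hsub := norm_sub_le 1 (Complex.exp (-z))
    rw [norm_one] at hsub
    linarith [Real.one_le_rpow hge hθ.1]

theorem tendsto_inv_mul_norm_one_sub_exp (z : ℂ) :
    Tendsto (fun t : ℝ => t⁻¹ * ‖1 - Complex.exp (-t * z)‖) (𝓝[>] 0) (𝓝 ‖z‖) := by
  have hderiv : HasDerivAt (fun t : ℝ => Complex.exp (-t * z)) (-z) 0 := by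
    have hlin : HasDerivAt (fun t : ℝ => -(t : ℂ) * z) (-1 * z) 0 :=
      (Complex.ofRealCLM.hasDerivAt (x := 0)).neg.mul_const z
    simpa using hlin.cexp
  have hslope := hderiv.tendsto_slope_zero_right.norm
  rw [norm_neg] at hslope
  refine hslope.congr' ?_
  filter_upwards [self_mem_nhdsWithin] with t ht
  rw [norm_smul, Real.norm_of_nonneg (inv_nonneg.2 (le_of_lt ht)), norm_sub_rev]
  simp

theorem norm_le_mul_norm_of_forall_one_sub_exp {z w : ℂ} {c : ℝ}
    (h : ∀ t : ℝ, 0 < t → ‖1 - Complex.exp (-t * z)‖ ≤ c * ‖1 - Complex.exp (-t * w)‖) :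
    ‖z‖ ≤ c * ‖w‖ := by
  refine le_of_tendsto_of_tendsto (tendsto_inv_mul_norm_one_sub_exp z)
    ((tendsto_inv_mul_norm_one_sub_exp w).const_mul c) ?_
  filter_upwards [self_mem_nhdsWithin] with t ht
  rw [mul_left_comm]
  exact mul_le_mul_of_nonneg_left (h t ht) (inv_nonneg.2 (le_of_lt ht))

theorem norm_one_sub_sq_of_norm_eq_one {w : ℂ} (hw : ‖w‖ = 1) :
    ‖(1 - w) ^ 2‖ = 2 * (1 - w).re := by
  have hsq : w.re * w.re + w.im * w.im = 1 := by
    rw [← Complex.normSq_apply, Complex.normSq_eq_norm_sq, hw, one_pow]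
  rw [norm_pow, ← Complex.normSq_eq_norm_sq, Complex.normSq_apply]
  simp only [Complex.sub_re, Complex.sub_im, Complex.one_re, Complex.one_im]
  linarith

end ComplexExponential

theorem norm_le_four_pow_mul_of_doubling {E F : Type*} [SeminormedAddCommGroup E]
    [NormedSpace ℝ E] [Norm F] {Ψ : E → F} {M : ℝ}
    (hdouble : ∀ ξ, ‖Ψ ((2 : ℝ) • ξ)‖ ≤ 4 * ‖Ψ ξ‖) (hM : ∀ ξ, ‖ξ‖ ≤ 1 → ‖Ψ ξ‖ ≤ M) (k : ℕ) :
    ∀ ξ, ‖ξ‖ ≤ 2 ^ k → ‖Ψ ξ‖ ≤ 4 ^ k * M := by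
  induction k with
  | zero => simpa using hM
  | succ k ih =>
    intro ξ hξ
    have hhalf : ‖(2⁻¹ : ℝ) • ξ‖ ≤ 2 ^ k := by
      rw [norm_smul, Real.norm_of_nonneg (by norm_num)]
      rw [pow_succ] at hξ
      linarith
    calc ‖Ψ ξ‖ = ‖Ψ ((2 : ℝ) • (2⁻¹ : ℝ) • ξ)‖ := by rw [smul_inv_smul₀ two_ne_zero]
      _ ≤ 4 * ‖Ψ ((2⁻¹ : ℝ) • ξ)‖ := hdouble _
      _ ≤ 4 * (4 ^ k * M) := by gcongr; exact ih _ hhalf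
      _ = 4 ^ (k + 1) * M := by ring

theorem exists_norm_le_mul_one_add_norm_sq {E F : Type*} [SeminormedAddCommGroup E]
    [NormedSpace ℝ E] [ProperSpace E] [SeminormedAddCommGroup F] {Ψ : E → F} (hΨ : Continuous Ψ)
    (hdouble : ∀ ξ, ‖Ψ ((2 : ℝ) • ξ)‖ ≤ 4 * ‖Ψ ξ‖) :
    ∃ M, 0 ≤ M ∧ ∀ ξ, ‖Ψ ξ‖ ≤ M * (1 + ‖ξ‖) ^ 2 := by
  obtain ⟨M, hM⟩ :=
    (isCompact_closedBall (0 : E) 1).exists_bound_of_continuousOn hΨ.continuousOn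
  have hM0 : 0 ≤ M := (norm_nonneg _).trans (hM 0 (by simp))
  have hball : ∀ ξ : E, ‖ξ‖ ≤ 1 → ‖Ψ ξ‖ ≤ M := fun ξ hξ => hM ξ (by simpa using hξ)
  refine ⟨4 * M, by positivity, fun ξ => ?_⟩
  obtain ⟨k, hk, hk'⟩ :=
    exists_nat_pow_near (le_add_of_nonneg_right (norm_nonneg ξ)) (one_lt_two (α := ℝ))
  calc ‖Ψ ξ‖ ≤ 4 ^ (k + 1) * M :=
        norm_le_four_pow_mul_of_doubling hdouble hball _ ξ (by linarith)
    _ = 4 * M * (2 ^ k) ^ 2 := by rw [← pow_mul, mul_comm k, pow_mul]; norm_num; ring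
    _ ≤ 4 * M * (1 + ‖ξ‖) ^ 2 := by gcongr

section CharExponent

open scoped RealInnerProductSpace

variable {V : Type*} [NormedAddCommGroup V] [InnerProductSpace ℝ V] [MeasurableSpace V]

theorem integrable_exp_inner_mul_I [OpensMeasurableSpace V] [SecondCountableTopology V]
    (μ : Measure V) [IsFiniteMeasure μ] (ξ : V) :
    Integrable (fun x => Complex.exp (⟪x, ξ⟫ * Complex.I)) μ :=
  .of_bound (by fun_prop) 1 (.of_forall fun _ => (Complex.norm_exp_ofReal_mul_I _).le)

theorem one_sub_charFun_eq_integral [OpensMeasurableSpace V] [SecondCountableTopology V]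
    (μ : Measure V) [IsProbabilityMeasure μ] (ξ : V) :
    1 - charFun μ ξ = ∫ x, (1 - Complex.exp (⟪x, ξ⟫ * Complex.I)) ∂μ := by
  rw [integral_sub (integrable_const 1) (integrable_exp_inner_mul_I μ ξ), charFun_apply]
  simp

theorem norm_one_sub_charFun_two_smul_le [OpensMeasurableSpace V] [SecondCountableTopology V]
    (μ : Measure V) [IsProbabilityMeasure μ] (ξ : V) :
    ‖1 - charFun μ ((2 : ℝ) • ξ)‖ ≤ 4 * ‖1 - charFun μ ξ‖ := by
  set w : V → ℂ := fun x => Complex.exp (⟪x, ξ⟫ * Complex.I) with hw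
  have hnorm (x : V) : ‖w x‖ = 1 := Complex.norm_exp_ofReal_mul_I _
  have hsub : Integrable (fun x => 1 - w x) μ :=
    (integrable_const 1).sub (integrable_exp_inner_mul_I μ ξ)
  have hsq : Integrable (fun x => (1 - w x) ^ 2) μ := by
    refine .of_bound (by fun_prop) 4 (.of_forall fun x => ?_)
    rw [norm_one_sub_sq_of_norm_eq_one (hnorm x), Complex.sub_re, Complex.one_re]
    linarith [Complex.abs_re_le_norm (w x), neg_abs_le (w x).re, hnorm x]
  have hidentity : 1 - charFun μ ((2 : ℝ) • ξ) =
      2 * (1 - charFun μ ξ) - ∫ x, (1 - w x) ^ 2 ∂μ := by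
    rw [one_sub_charFun_eq_integral, one_sub_charFun_eq_integral, ← integral_const_mul,
      ← integral_sub (hsub.const_mul 2) hsq]
    congr 1 with x
    have hw2 : Complex.exp (⟪x, (2 : ℝ) • ξ⟫ * Complex.I) = w x ^ 2 := by
      rw [hw, ← Complex.exp_nat_mul, inner_smul_right]
      push_cast
      ring_nf
    rw [hw2]
    ring
  have hsq_le : ‖∫ x, (1 - w x) ^ 2 ∂μ‖ ≤ 2 * ‖1 - charFun μ ξ‖ := by
    calc ‖∫ x, (1 - w x) ^ 2 ∂μ‖ ≤ ∫ x, ‖(1 - w x) ^ 2‖ ∂μ := norm_integral_le_integral_norm _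
      _ = 2 * (1 - charFun μ ξ).re := by
          simp_rw [fun x => norm_one_sub_sq_of_norm_eq_one (hnorm x)]
          rw [integral_const_mul, one_sub_charFun_eq_integral]
          exact congrArg (2 * ·) (integral_re hsub)
      _ ≤ 2 * ‖1 - charFun μ ξ‖ := by gcongr; exact Complex.re_le_norm _
  calc ‖1 - charFun μ ((2 : ℝ) • ξ)‖
      ≤ ‖2 * (1 - charFun μ ξ)‖ + ‖∫ x, (1 - w x) ^ 2 ∂μ‖ := hidentity ▸ norm_sub_le _ _
    _ ≤ 4 * ‖1 - charFun μ ξ‖ := by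
        rw [norm_mul, Complex.norm_ofNat]
        linarith

/-- `Ψ` is the characteristic exponent of the family of probability measures `μ`; the marginals
of a Lévy process are the case of interest. -/
structure HasCharExponent (μ : ℝ≥0 → Measure V) (Ψ : V → ℂ) : Prop where
  isProbabilityMeasure : ∀ t, IsProbabilityMeasure (μ t)
  continuous : Continuous Ψ
  charFun_eq : ∀ (t : ℝ≥0) (ξ : V), charFun (μ t) ξ = Complex.exp (-((t : ℝ) : ℂ) * Ψ ξ)

theorem IsCharExponent.hasCharExponent {Ω : Type*} [MeasurableSpace Ω] {n : ℕ} {P : Measure Ω}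
    [IsProbabilityMeasure P] {X : ℝ≥0 → Ω → EuclideanSpace ℝ (Fin n)}
    {Ψ : EuclideanSpace ℝ (Fin n) → ℂ} (hΨ : IsCharExponent P X Ψ) (hX : ∀ t, Measurable (X t)) :
    HasCharExponent (fun t => P.map (X t)) Ψ where
  isProbabilityMeasure t := Measure.isProbabilityMeasure_map (hX t).aemeasurable
  continuous := hΨ.continuous
  charFun_eq := hΨ.charFun_eq

namespace HasCharExponent

variable {μ : ℝ≥0 → Measure V} {Ψ : V → ℂ}

theorem norm_charFun_eq (hΨ : HasCharExponent μ Ψ) (t : ℝ≥0) (ξ : V) :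
    ‖charFun (μ t) ξ‖ = Real.exp (-t * (Ψ ξ).re) := by
  rw [hΨ.charFun_eq, Complex.norm_exp]
  congr 1
  simp

theorem re_nonneg (hΨ : HasCharExponent μ Ψ) (ξ : V) : 0 ≤ (Ψ ξ).re := by
  have := hΨ.isProbabilityMeasure 1
  have h := norm_charFun_le_one (μ := μ 1) ξ
  rw [hΨ.norm_charFun_eq, Real.exp_le_one_iff] at h
  simpa using h

theorem map_zero (hΨ : HasCharExponent μ Ψ) : Ψ 0 = 0 := by
  have hnorm : ‖Ψ 0‖ ≤ 0 * ‖(0 : ℂ)‖ := by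
    refine norm_le_mul_norm_of_forall_one_sub_exp fun t ht => ?_
    lift t to ℝ≥0 using ht.le
    have := hΨ.isProbabilityMeasure t
    rw [← hΨ.charFun_eq t 0, charFun_zero]
    simp
  simpa using hnorm

theorem norm_one_sub_charFun_le (hΨ : HasCharExponent μ Ψ) (t : ℝ≥0) (ξ : V) :
    ‖1 - charFun (μ t) ξ‖ ≤ t * ‖Ψ ξ‖ := by
  have hre : 0 ≤ (((t : ℝ) : ℂ) * Ψ ξ).re := by
    rw [Complex.re_ofReal_mul]
    exact mul_nonneg t.coe_nonneg (hΨ.re_nonneg ξ)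
  simpa [hΨ.charFun_eq] using norm_one_sub_exp_neg_le hre

theorem norm_two_smul_le [OpensMeasurableSpace V] [SecondCountableTopology V]
    (hΨ : HasCharExponent μ Ψ) (ξ : V) : ‖Ψ ((2 : ℝ) • ξ)‖ ≤ 4 * ‖Ψ ξ‖ := by
  refine norm_le_mul_norm_of_forall_one_sub_exp fun t ht => ?_
  lift t to ℝ≥0 using ht.le
  have := hΨ.isProbabilityMeasure t
  simpa only [hΨ.charFun_eq] using norm_one_sub_charFun_two_smul_le (μ t) ξ

end HasCharExponent

end CharExponent

section Tail

open scoped RealInnerProductSpace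
open Module (finrank)

variable {V : Type*} [NormedAddCommGroup V] [InnerProductSpace ℝ V] [FiniteDimensional ℝ V]
  [MeasurableSpace V] [BorelSpace V]

theorem setIntegral_comp_add_right_le {f : V → ℝ} (hf0 : ∀ x, 0 ≤ f x) {s t : Set V}
    (hf : IntegrableOn f t) (v : V) (hst : ∀ x ∈ s, x + v ∈ t) :
    ∫ x in s, f (x + v) ≤ ∫ x in t, f x := by
  have hmp := measurePreserving_add_right (volume : Measure V) v
  have hme := (Homeomorph.addRight v).measurableEmbedding
  rw [← hmp.setIntegral_preimage_emb hme f t]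
  exact setIntegral_mono_set ((hmp.integrableOn_comp_preimage hme).2 hf)
    (.of_forall fun x => hf0 _) (LE.le.eventuallyLE hst)

/-- A translation by a vector `v` parallel to `x` with `⟪x, v⟫ = π` replaces `1 - cos` by
`1 + cos`, and it maps the ball of radius `ρ / 2` into the ball of radius `ρ`. -/
theorem volume_closedBall_half_le_integral_one_sub_cos {ρ : ℝ} (hρ : 0 < ρ) {x : V}
    (hx : 2 * Real.pi / ρ ≤ ‖x‖) :
    volume.real (Metric.closedBall (0 : V) (ρ / 2)) ≤
      ∫ ξ in Metric.closedBall (0 : V) ρ, (1 - Real.cos ⟪x, ξ⟫) := by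
  have hx0 : 0 < ‖x‖ := lt_of_lt_of_le (by positivity) hx
  set f : V → ℝ := fun ξ => 1 - Real.cos ⟪x, ξ⟫ with hf
  have hcont : Continuous f := by fun_prop
  have hshift (w : V) : Continuous fun ξ => f (ξ + w) := hcont.comp (continuous_add_const w)
  have hf0 (ξ : V) : 0 ≤ f ξ := sub_nonneg.2 (Real.cos_le_one _)
  have hint {g : V → ℝ} (hg : Continuous g) (r : ℝ) :
      IntegrableOn g (Metric.closedBall (0 : V) r) :=
    hg.continuousOn.integrableOn_compact (isCompact_closedBall _ _)
  set v : V := (Real.pi / ‖x‖ ^ 2) • x with hv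
  have hvnorm : ‖v‖ ≤ ρ / 2 := by
    rw [div_le_iff₀ hρ] at hx
    have hcancel : Real.pi / ‖x‖ ^ 2 * ‖x‖ = Real.pi / ‖x‖ := by field_simp
    rw [hv, norm_smul, Real.norm_of_nonneg (by positivity), hcancel, div_le_iff₀ hx0]
    linarith
  have hsum (ξ : V) : f ξ + f (ξ + v) = 2 := by
    have hinner : ⟪x, ξ + v⟫ = ⟪x, ξ⟫ + Real.pi := by
      rw [inner_add_right, hv, inner_smul_right, real_inner_self_eq_norm_sq]
      field_simp
    simp only [hf, hinner, Real.cos_add_pi]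
    ring
  have hhalf (w : V) (hw : ‖w‖ ≤ ρ / 2) :
      ∫ ξ in Metric.closedBall (0 : V) (ρ / 2), f (ξ + w) ≤
        ∫ ξ in Metric.closedBall (0 : V) ρ, f ξ :=
    setIntegral_comp_add_right_le hf0 (hint hcont ρ) w fun y hy => by
      rw [mem_closedBall_zero_iff] at hy ⊢
      linarith [norm_add_le y w]
  have htwo : ∫ ξ in Metric.closedBall (0 : V) (ρ / 2), (f ξ + f (ξ + v)) =
      2 * volume.real (Metric.closedBall (0 : V) (ρ / 2)) := by
    simp_rw [hsum]
    simp [mul_comm]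
  rw [integral_add (hint hcont _) (hint (hshift v) _)] at htwo
  have hleft := hhalf 0 (by rw [norm_zero]; positivity)
  simp only [add_zero] at hleft
  linarith [hhalf v hvnorm]

theorem one_sub_re_charFun_eq_integral (μ : Measure V) [IsProbabilityMeasure μ] (ξ : V) :
    1 - (charFun μ ξ).re = ∫ x, (1 - Real.cos ⟪x, ξ⟫) ∂μ := by
  have hint := (integrable_const 1).sub (integrable_exp_inner_mul_I μ ξ)
  calc 1 - (charFun μ ξ).re = (1 - charFun μ ξ).re := by simp
    _ = ∫ x, (1 - Complex.exp (⟪x, ξ⟫ * Complex.I)).re ∂μ := by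
        rw [one_sub_charFun_eq_integral]
        exact (integral_re hint).symm
    _ = ∫ x, (1 - Real.cos ⟪x, ξ⟫) ∂μ := by
        simp only [Complex.sub_re, Complex.one_re, Complex.exp_ofReal_mul_I_re]

theorem measureReal_le_norm_mul_le_integral_charFun (μ : Measure V) [IsProbabilityMeasure μ]
    {ρ : ℝ} (hρ : 0 < ρ) :
    μ.real {x | 2 * Real.pi / ρ ≤ ‖x‖} * volume.real (Metric.closedBall (0 : V) (ρ / 2)) ≤
      ∫ ξ in Metric.closedBall (0 : V) ρ, (1 - (charFun μ ξ).re) := by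
  set S := {x : V | 2 * Real.pi / ρ ≤ ‖x‖}
  set B := Metric.closedBall (0 : V) ρ
  have hB : IsFiniteMeasure ((volume : Measure V).restrict B) :=
    isFiniteMeasure_restrict.2 measure_closedBall_lt_top.ne
  have hS : MeasurableSet S := measurableSet_le measurable_const measurable_norm
  have hprod : Integrable (Function.uncurry fun x ξ : V => 1 - Real.cos ⟪x, ξ⟫)
      (μ.prod (volume.restrict B)) := by
    refine .of_bound (Continuous.aestronglyMeasurable ?_) 2 (.of_forall fun p => ?_)
    · unfold Function.uncurry
      fun_prop
    · rw [Function.uncurry, Real.norm_eq_abs, abs_le]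
      constructor <;> linarith [Real.cos_le_one ⟪p.1, p.2⟫, Real.neg_one_le_cos ⟪p.1, p.2⟫]
  calc μ.real S * volume.real (Metric.closedBall (0 : V) (ρ / 2))
      = ∫ x in S, volume.real (Metric.closedBall (0 : V) (ρ / 2)) ∂μ := by simp
    _ ≤ ∫ x in S, (∫ ξ in B, (1 - Real.cos ⟪x, ξ⟫)) ∂μ :=
        setIntegral_mono_on (integrable_const _).integrableOn hprod.integral_prod_left.integrableOn
          hS fun x hx => volume_closedBall_half_le_integral_one_sub_cos hρ hx
    _ ≤ ∫ x, (∫ ξ in B, (1 - Real.cos ⟪x, ξ⟫)) ∂μ :=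
        setIntegral_le_integral hprod.integral_prod_left
          (.of_forall fun x => integral_nonneg fun ξ => sub_nonneg.2 (Real.cos_le_one _))
    _ = ∫ ξ in B, (∫ x, (1 - Real.cos ⟪x, ξ⟫) ∂μ) := integral_integral_swap hprod
    _ = ∫ ξ in B, (1 - (charFun μ ξ).re) := by simp_rw [one_sub_re_charFun_eq_integral]

theorem setIntegral_closedBall_le_rpow_mul {f : V → ℝ} (hf0 : ∀ ξ, 0 ≤ f ξ)
    (hf : Continuous f) (hzero : f 0 = 0) {a ρ : ℝ} (ha : 0 ≤ a) (hρ : 0 < ρ) (hρ1 : ρ ≤ 1)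
    (hint : IntegrableOn (fun ξ => f ξ / ‖ξ‖ ^ a) (Metric.closedBall (0 : V) 1)) :
    ∫ ξ in Metric.closedBall (0 : V) ρ, f ξ ≤
      ρ ^ a * ∫ ξ in Metric.closedBall (0 : V) 1, f ξ / ‖ξ‖ ^ a := by
  have hsub : Metric.closedBall (0 : V) ρ ⊆ Metric.closedBall 0 1 :=
    Metric.closedBall_subset_closedBall hρ1
  have hpoint : ∀ ξ ∈ Metric.closedBall (0 : V) ρ, f ξ ≤ ρ ^ a * (f ξ / ‖ξ‖ ^ a) := by
    intro ξ hξ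
    rcases eq_or_ne ξ 0 with rfl | hne
    · simp [hzero]
    · have hpos : 0 < ‖ξ‖ ^ a := Real.rpow_pos_of_pos (norm_pos_iff.2 hne) _
      rw [mul_div_assoc', le_div_iff₀ hpos, mul_comm]
      gcongr
      · exact hf0 ξ
      · simpa using hξ
  calc ∫ ξ in Metric.closedBall (0 : V) ρ, f ξ
      ≤ ∫ ξ in Metric.closedBall (0 : V) ρ, ρ ^ a * (f ξ / ‖ξ‖ ^ a) :=
        setIntegral_mono_on (hf.continuousOn.integrableOn_compact (isCompact_closedBall _ _))
          ((hint.mono_set hsub).const_mul _) Metric.isClosed_closedBall.measurableSet hpoint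
    _ ≤ ρ ^ a * ∫ ξ in Metric.closedBall (0 : V) 1, f ξ / ‖ξ‖ ^ a := by
        rw [integral_const_mul]
        gcongr ρ ^ a * ?_
        exact setIntegral_mono_set hint
          (.of_forall fun ξ => div_nonneg (hf0 ξ) (by positivity)) (LE.le.eventuallyLE hsub)

theorem HasCharExponent.exists_measureReal_two_pi_div_le_norm_le {μ : ℝ≥0 → Measure V} {Ψ : V → ℂ}
    (hΨ : HasCharExponent μ Ψ) {β₀ : ℝ} (hβ₀ : 0 ≤ β₀)
    (hzero : IntegrableOn (fun ξ => ‖Ψ ξ‖ / ‖ξ‖ ^ ((finrank ℝ V : ℝ) + β₀))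
      (Metric.closedBall (0 : V) 1)) :
    ∃ L, 0 ≤ L ∧ ∀ t, ∀ ρ, 0 < ρ → ρ ≤ 1 →
      (μ t).real {x | 2 * Real.pi / ρ ≤ ‖x‖} ≤ t * L * ρ ^ β₀ := by
  set d := finrank ℝ V
  set I := ∫ ξ in Metric.closedBall (0 : V) 1, ‖Ψ ξ‖ / ‖ξ‖ ^ ((d : ℝ) + β₀)
  set v := volume.real (Metric.closedBall (0 : V) 1)
  have hv : 0 < v := ENNReal.toReal_pos (Metric.measure_closedBall_pos volume _ one_pos).ne'
    measure_closedBall_lt_top.ne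
  refine ⟨2 ^ d * I / v, by positivity, fun t ρ hρ hρ1 => ?_⟩
  have := hΨ.isProbabilityMeasure t
  have hvol : volume.real (Metric.closedBall (0 : V) (ρ / 2)) = (ρ / 2) ^ d * v :=
    Measure.addHaar_real_closedBall' _ _ (by positivity)
  have hnorm := hΨ.continuous.norm
  have hint {f : V → ℝ} (hf : Continuous f) : IntegrableOn f (Metric.closedBall (0 : V) ρ) :=
    hf.continuousOn.integrableOn_compact (isCompact_closedBall _ _)
  have hint_charFun : ∫ ξ in Metric.closedBall (0 : V) ρ, (1 - (charFun (μ t) ξ).re) ≤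
      t * (ρ ^ ((d : ℝ) + β₀) * I) := by
    calc ∫ ξ in Metric.closedBall (0 : V) ρ, (1 - (charFun (μ t) ξ).re)
        ≤ ∫ ξ in Metric.closedBall (0 : V) ρ, t * ‖Ψ ξ‖ := by
          refine integral_mono (hint (by fun_prop)) (hint (hnorm.const_mul _)) fun ξ => ?_
          exact (Complex.re_le_norm (1 - charFun (μ t) ξ)).trans (hΨ.norm_one_sub_charFun_le t ξ)
      _ ≤ t * (ρ ^ ((d : ℝ) + β₀) * I) := by
          rw [integral_const_mul]
          gcongr
          exact setIntegral_closedBall_le_rpow_mul (fun ξ => norm_nonneg _) hnorm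
            (by simp [hΨ.map_zero]) (by positivity) hρ hρ1 hzero
  have htail := (measureReal_le_norm_mul_le_integral_charFun (μ t) hρ).trans hint_charFun
  rw [hvol, ← le_div_iff₀ (by positivity), Real.rpow_add hρ, Real.rpow_natCast, div_pow] at htail
  refine htail.trans_eq ?_
  field_simp

theorem HasCharExponent.exists_measureReal_le_norm_le {μ : ℝ≥0 → Measure V} {Ψ : V → ℂ}
    (hΨ : HasCharExponent μ Ψ) {β₀ : ℝ} (hβ₀ : 0 < β₀)
    (hzero : IntegrableOn (fun ξ => ‖Ψ ξ‖ / ‖ξ‖ ^ ((finrank ℝ V : ℝ) + β₀))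
      (Metric.closedBall (0 : V) 1)) (T : ℝ≥0) :
    ∃ K, 0 ≤ K ∧ ∀ t ≤ T, ∀ R, 0 < R → (μ t).real {x | R ≤ ‖x‖} ≤ K * R ^ (-β₀) := by
  obtain ⟨L, hL, htail⟩ := hΨ.exists_measureReal_two_pi_div_le_norm_le hβ₀.le hzero
  refine ⟨(T * L + 1) * (2 * Real.pi) ^ β₀, by positivity, fun t ht R hR => ?_⟩
  have := hΨ.isProbabilityMeasure t
  set ρ := 2 * Real.pi / R with hρ
  have hρ0 : 0 < ρ := by positivity
  have hR_eq : R = 2 * Real.pi / ρ := by rw [hρ]; field_simp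
  have hpow : (2 * Real.pi) ^ β₀ * R ^ (-β₀) = ρ ^ β₀ := by
    rw [hρ, Real.div_rpow (by positivity) hR.le, Real.rpow_neg hR.le, div_eq_mul_inv]
  rw [mul_assoc, hpow]
  rcases le_total ρ 1 with hρ1 | hρ1
  · rw [hR_eq]
    calc (μ t).real {x | 2 * Real.pi / ρ ≤ ‖x‖} ≤ t * L * ρ ^ β₀ :=
          htail t ρ hρ0 hρ1
      _ ≤ (T * L + 1) * ρ ^ β₀ := by
          gcongr
          exact (mul_le_mul_of_nonneg_right (NNReal.coe_le_coe.2 ht) hL).trans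
            (le_add_of_nonneg_right zero_le_one)
  · calc (μ t).real {x | R ≤ ‖x‖} ≤ 1 := measureReal_le_one
      _ ≤ ρ ^ β₀ := Real.one_le_rpow hρ1 hβ₀.le
      _ ≤ (T * L + 1) * ρ ^ β₀ :=
          le_mul_of_one_le_left (by positivity) (le_add_of_nonneg_left (by positivity))

end Tail

section Growth

open Asymptotics
open Module (finrank)

theorem eventually_rpow_le_re_of_lt_lowerIndexAtInfinity {n : ℕ}
    {Ψ : EuclideanSpace ℝ (Fin n) → ℂ} {b : ℝ} (hb : (b : EReal) < lowerIndexAtInfinity Ψ) :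
    ∀ᶠ ξ in Bornology.cobounded (EuclideanSpace ℝ (Fin n)), ‖ξ‖ ^ b ≤ (Ψ ξ).re := by
  filter_upwards [eventually_lt_of_lt_liminf hb, eventually_cobounded_le_norm 2] with ξ hlt hξ
  have hlog : 0 < Real.log ‖ξ‖ := Real.log_pos (by linarith)
  rw [EReal.lt_div_iff (by exact_mod_cast hlog) (EReal.coe_ne_top _)] at hlt
  have hpos : 0 < (Ψ ξ).re := by
    by_contra! hle
    rw [ENNReal.ofReal_eq_zero.2 hle, ENNReal.log_zero] at hlt
    exact not_lt_bot hlt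
  rw [ENNReal.log_ofReal_of_pos hpos, ← EReal.coe_mul, EReal.coe_lt_coe_iff] at hlt
  rw [Real.rpow_def_of_pos (by linarith), ← Real.le_log_iff_exp_le hpos, mul_comm]
  exact hlt.le

theorem exists_rpow_sub_le_of_eventually_rpow_le {E : Type*} [SeminormedAddCommGroup E]
    {f : E → ℝ} (hf : ∀ ξ, 0 ≤ f ξ) {b : ℝ} (hb : 0 ≤ b)
    (h : ∀ᶠ ξ in Bornology.cobounded E, ‖ξ‖ ^ b ≤ f ξ) :
    ∃ c, 0 ≤ c ∧ ∀ ξ, ‖ξ‖ ^ b - c ≤ f ξ := by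
  obtain ⟨L, -, hL⟩ := (hasBasis_cobounded_norm (E := E)).eventually_iff.1 h
  refine ⟨(max L 0) ^ b, by positivity, fun ξ => ?_⟩
  rcases le_total L ‖ξ‖ with hξ | hξ
  · linarith [hL hξ, Real.rpow_nonneg (le_max_right L 0) b]
  · have hpow : ‖ξ‖ ^ b ≤ (max L 0) ^ b := by
      gcongr
      exact hξ.trans (le_max_left _ _)
    linarith [hf ξ]

variable {V : Type*} [NormedAddCommGroup V] [NormedSpace ℝ V] [FiniteDimensional ℝ V]
  [MeasurableSpace V] [BorelSpace V] (μ : Measure V) [μ.IsAddHaarMeasure]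

theorem integrable_one_add_norm_rpow_mul_exp_neg_mul_norm_rpow (m : ℝ) {a b : ℝ} (ha : 0 < a)
    (hb : 0 < b) :
    Integrable (fun ξ : V => (1 + ‖ξ‖) ^ m * Real.exp (-a * ‖ξ‖ ^ b)) μ := by
  have hcont : Continuous fun ξ : V => (1 + ‖ξ‖) ^ m * Real.exp (-a * ‖ξ‖ ^ b) := by
    refine Continuous.mul (Continuous.rpow_const (by fun_prop) fun ξ => .inl ?_) ?_
    · positivity
    · exact Real.continuous_exp.comp
        ((continuous_norm.rpow_const fun _ => .inr hb.le).const_mul _)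
  set d : ℝ := finrank ℝ V + 1
  set a' := a * 2⁻¹ ^ b with ha'
  have hone (ξ : V) : 0 < 1 + ‖ξ‖ := by positivity
  have htop : Tendsto (fun ξ : V => (1 + ‖ξ‖) ^ b) (cocompact V) atTop :=
    (tendsto_rpow_atTop hb).comp
      (tendsto_atTop_add_const_left _ 1 tendsto_norm_cocompact_atTop)
  have hexp : (fun ξ : V => Real.exp (-a * ‖ξ‖ ^ b)) =O[cocompact V]
      fun ξ => Real.exp (-a' * (1 + ‖ξ‖) ^ b) := by
    refine .of_bound' ?_
    filter_upwards [tendsto_norm_cocompact_atTop.eventually_ge_atTop 1] with ξ hξ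
    rw [Real.norm_of_nonneg (Real.exp_nonneg _), Real.norm_of_nonneg (Real.exp_nonneg _),
      Real.exp_le_exp, ha', neg_mul, neg_mul, mul_assoc, ← Real.mul_rpow (by norm_num) (hone ξ).le]
    gcongr
    linarith
  have hdecay : (fun ξ : V => Real.exp (-a' * (1 + ‖ξ‖) ^ b)) =O[cocompact V]
      fun ξ => (1 + ‖ξ‖) ^ (-d - m) := by
    refine ((isLittleO_exp_neg_mul_rpow_atTop (by positivity : 0 < a') ((-d - m) / b)).comp_tendsto
      htop).isBigO.congr_right fun ξ => ?_
    rw [Function.comp_apply, ← Real.rpow_mul (hone ξ).le, mul_div_cancel₀ _ hb.ne']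
  have hbigO : (fun ξ : V => (1 + ‖ξ‖) ^ m * Real.exp (-a * ‖ξ‖ ^ b)) =O[cocompact V]
      fun ξ => (1 + ‖ξ‖) ^ (-d) :=
    ((isBigO_refl _ _).mul (hexp.trans hdecay)).congr_right fun ξ => by
      rw [← Real.rpow_add (hone ξ), add_sub_cancel]
  exact hcont.locallyIntegrable.integrable_of_isBigO_cocompact hbigO
    ((integrable_one_add_norm (by linarith)).integrableAtFilter _)

/-- Rescaling `ξ` by `(T / t) ^ b⁻¹ ≥ 1` turns `t * ‖ξ‖ ^ b` into `T * ‖ξ‖ ^ b`. -/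
theorem integral_one_add_norm_rpow_mul_exp_neg_mul_le {s m t T b : ℝ} (hs : 0 ≤ s) (hsm : s ≤ m)
    (ht : 0 < t) (htT : t ≤ T) (hb : 0 < b) :
    ∫ ξ : V, (1 + ‖ξ‖) ^ s * Real.exp (-t * ‖ξ‖ ^ b) ∂μ ≤
      (T / t) ^ ((s + finrank ℝ V) / b) * ∫ ξ : V, (1 + ‖ξ‖) ^ m * Real.exp (-T * ‖ξ‖ ^ b) ∂μ := by
  have hT : 0 < T := ht.trans_le htT
  set r := (T / t) ^ b⁻¹ with hr
  have hratio : 1 ≤ T / t := (one_le_div ht).2 htT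
  have hr1 : 1 ≤ r := Real.one_le_rpow hratio (by positivity)
  have hrb : t * r ^ b = T := by
    rw [hr, Real.rpow_inv_rpow (by positivity) hb.ne']
    field_simp
  have hrpow : (T / t) ^ ((s + finrank ℝ V) / b) = r ^ finrank ℝ V * r ^ s := by
    rw [hr, ← Real.rpow_natCast, ← Real.rpow_add (by positivity), ← Real.rpow_mul (by positivity)]
    ring_nf
  set G : V → ℝ := fun ξ => (1 + ‖ξ‖) ^ s * Real.exp (-t * ‖ξ‖ ^ b) with hG
  have hchange : ∫ ξ, G ξ ∂μ = r ^ finrank ℝ V * ∫ ξ, G (r • ξ) ∂μ := by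
    rw [Measure.integral_comp_smul, abs_of_pos (by positivity), smul_eq_mul,
      mul_inv_cancel_left₀ (by positivity)]
  have hpoint (ξ : V) : G (r • ξ) ≤ r ^ s * ((1 + ‖ξ‖) ^ m * Real.exp (-T * ‖ξ‖ ^ b)) := by
    have hexp : -t * ‖r • ξ‖ ^ b = -T * ‖ξ‖ ^ b := by
      rw [norm_smul, Real.norm_of_nonneg (by positivity),
        Real.mul_rpow (by positivity) (norm_nonneg _), ← hrb]
      ring
    have hbase : 1 + ‖r • ξ‖ ≤ r * (1 + ‖ξ‖) := by
      rw [norm_smul, Real.norm_of_nonneg (by positivity)]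
      linarith
    have hpow : (1 + ‖r • ξ‖) ^ s ≤ r ^ s * (1 + ‖ξ‖) ^ m := by
      calc (1 + ‖r • ξ‖) ^ s ≤ (r * (1 + ‖ξ‖)) ^ s := by gcongr
        _ = r ^ s * (1 + ‖ξ‖) ^ s := Real.mul_rpow (by positivity) (by positivity)
        _ ≤ r ^ s * (1 + ‖ξ‖) ^ m := by
            gcongr
            exact le_add_of_nonneg_right (norm_nonneg ξ)
    rw [hG]
    beta_reduce
    rw [hexp, ← mul_assoc]
    gcongr
  rw [hchange, hrpow, mul_assoc, ← integral_const_mul (r ^ s)]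
  refine mul_le_mul_of_nonneg_left (integral_mono ?_ ?_ hpoint) (by positivity)
  · exact (integrable_one_add_norm_rpow_mul_exp_neg_mul_norm_rpow μ s ht hb).comp_smul
      (by positivity)
  · exact (integrable_one_add_norm_rpow_mul_exp_neg_mul_norm_rpow μ m hT hb).const_mul _

end Growth

section Moment

open Module (finrank)

theorem exists_pos_lt_forall_div_le {β m κ : ℝ} (hβ : 0 < β) (hm : 0 ≤ m) (hκ : 0 < κ) :
    ∃ b, 0 < b ∧ b < β ∧ ∀ s ≤ m, s / b ≤ s / β + κ := by
  have hinv : β⁻¹ < β⁻¹ + κ / (m + 1) := lt_add_of_pos_right _ (by positivity)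
  have hpos : 0 < β⁻¹ + κ / (m + 1) := by positivity
  refine ⟨(β⁻¹ + κ / (m + 1))⁻¹, inv_pos.2 hpos, inv_lt_of_inv_lt₀ hβ hinv, fun s hs => ?_⟩
  have hκs : s * (κ / (m + 1)) ≤ κ := by
    rw [mul_div_assoc', div_le_iff₀ (by positivity), mul_comm]
    gcongr
    linarith
  rw [div_inv_eq_mul, mul_add, ← div_eq_mul_inv]
  linarith

theorem div_rpow_le_rpow_div_rpow {S t p q r : ℝ} (hS : 1 ≤ S) (ht : 0 < t) (htS : t ≤ S)
    (hpq : p ≤ q) (hqr : q ≤ r) : (S / t) ^ p ≤ S ^ r / t ^ q := by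
  calc (S / t) ^ p ≤ (S / t) ^ q := Real.rpow_le_rpow_of_exponent_le ((one_le_div ht).2 htS) hpq
    _ = S ^ q / t ^ q := Real.div_rpow (by positivity) ht.le _
    _ ≤ S ^ r / t ^ q := by gcongr

variable {V : Type*} [NormedAddCommGroup V] [InnerProductSpace ℝ V] [MeasurableSpace V]
  {μ : ℝ≥0 → Measure V} {Ψ : V → ℂ}

theorem HasCharExponent.norm_charFun_le_of_rpow_sub_le (hΨ : HasCharExponent μ Ψ) {b c S : ℝ}
    (hc : 0 ≤ c) {ξ : V} (hre : ‖ξ‖ ^ b - c ≤ (Ψ ξ).re) {t : ℝ≥0} (htS : t ≤ S) :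
    ‖charFun (μ t) ξ‖ ≤ Real.exp (S * c) * Real.exp (-t * ‖ξ‖ ^ b) := by
  rw [hΨ.norm_charFun_eq, ← Real.exp_add, Real.exp_le_exp]
  linarith [mul_le_mul_of_nonneg_left hre t.coe_nonneg, mul_le_mul_of_nonneg_right htS hc]

theorem HasCharExponent.exists_integral_one_add_norm_rpow_mul_norm_charFun_le
    [FiniteDimensional ℝ V] [BorelSpace V] (hΨ : HasCharExponent μ Ψ) {β : ℝ} (hβ : 0 < β)
    (hinf : ∀ b < β, ∀ᶠ ξ in Bornology.cobounded V, ‖ξ‖ ^ b ≤ (Ψ ξ).re) {m : ℝ} (hm : 0 ≤ m)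
    {κ : ℝ} (hκ : 0 < κ) (T : ℝ≥0) :
    ∃ C, 0 ≤ C ∧ ∀ s ∈ Set.Icc 0 m, ∀ t : ℝ≥0, 0 < t → t ≤ T →
      Integrable (fun ξ => (1 + ‖ξ‖) ^ s * ‖charFun (μ t) ξ‖) ∧
      ∫ ξ, (1 + ‖ξ‖) ^ s * ‖charFun (μ t) ξ‖ ≤ C / t ^ ((s + finrank ℝ V) / β + κ) := by
  set d : ℝ := (finrank ℝ V : ℝ)
  obtain ⟨b, hb, hbβ, hexponent⟩ :=
    exists_pos_lt_forall_div_le hβ (by positivity : 0 ≤ m + d) hκ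
  obtain ⟨c, hc, hre⟩ := exists_rpow_sub_le_of_eventually_rpow_le hΨ.re_nonneg hb.le (hinf b hbβ)
  set S : ℝ := max T 1
  set J := ∫ ξ : V, (1 + ‖ξ‖) ^ m * Real.exp (-S * ‖ξ‖ ^ b)
  refine ⟨Real.exp (S * c) * (S ^ ((m + d) / β + κ) * J), by positivity, fun s hs t ht htT => ?_⟩
  have htS : (t : ℝ) ≤ S := (NNReal.coe_le_coe.2 htT).trans (le_max_left _ _)
  have hbound (ξ : V) : (1 + ‖ξ‖) ^ s * ‖charFun (μ t) ξ‖ ≤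
      Real.exp (S * c) * ((1 + ‖ξ‖) ^ s * Real.exp (-t * ‖ξ‖ ^ b)) := by
    rw [mul_left_comm]
    gcongr
    exact hΨ.norm_charFun_le_of_rpow_sub_le hc (hre ξ) htS
  have hint := (integrable_one_add_norm_rpow_mul_exp_neg_mul_norm_rpow (V := V) volume s ht
    hb).const_mul (Real.exp (S * c))
  have hcont : Continuous fun ξ => (1 + ‖ξ‖) ^ s * ‖charFun (μ t) ξ‖ :=
    have := hΨ.isProbabilityMeasure t
    ((continuous_const.add continuous_norm).rpow_const fun _ => .inr hs.1).mul
      continuous_charFun.norm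
  have hmoment : Integrable fun ξ => (1 + ‖ξ‖) ^ s * ‖charFun (μ t) ξ‖ :=
    hint.mono' hcont.aestronglyMeasurable (.of_forall fun ξ => by
      rw [Real.norm_of_nonneg (by positivity)]
      exact hbound ξ)
  refine ⟨hmoment, ?_⟩
  calc ∫ ξ, (1 + ‖ξ‖) ^ s * ‖charFun (μ t) ξ‖
      ≤ Real.exp (S * c) * ∫ ξ : V, (1 + ‖ξ‖) ^ s * Real.exp (-t * ‖ξ‖ ^ b) := by
        rw [← integral_const_mul]
        exact integral_mono hmoment hint hbound
    _ ≤ Real.exp (S * c) * ((S / t) ^ ((s + d) / b) * J) := by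
        gcongr
        exact integral_one_add_norm_rpow_mul_exp_neg_mul_le volume hs.1 hs.2 ht htS hb
    _ ≤ Real.exp (S * c) * (S ^ ((m + d) / β + κ) / t ^ ((s + d) / β + κ) * J) := by
        gcongr
        exact div_rpow_le_rpow_div_rpow (le_max_right _ _) ht htS
          (hexponent _ (by linarith [hs.2])) (by gcongr; exact hs.2)
    _ = Real.exp (S * c) * (S ^ ((m + d) / β + κ) * J) / t ^ ((s + d) / β + κ) := by ring

end Moment

section Interpolation

open Module (finrank)

variable {V : Type*} [NormedAddCommGroup V] [NormedSpace ℝ V] [FiniteDimensional ℝ V]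
  [MeasurableSpace V] [BorelSpace V] (μ : Measure V) [μ.IsAddHaarMeasure] {f : V → ℝ}

theorem setIntegral_ball_abs_le (hf : Integrable f μ) {B R : ℝ} (hR : 0 < R)
    (hsup : ∀ᵐ x ∂μ, |f x| ≤ B) :
    ∫ x in Metric.ball 0 R, |f x| ∂μ ≤ R ^ finrank ℝ V * μ.real (Metric.ball 0 1) * B := by
  calc ∫ x in Metric.ball 0 R, |f x| ∂μ ≤ ∫ _ in Metric.ball (0 : V) R, B ∂μ :=
        setIntegral_mono_ae hf.abs.integrableOn (integrableOn_const measure_ball_lt_top.ne) hsup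
    _ = R ^ finrank ℝ V * μ.real (Metric.ball 0 1) * B := by
        rw [setIntegral_const, Measure.real, Measure.addHaar_ball_of_pos _ _ hR,
          ENNReal.toReal_mul, ENNReal.toReal_ofReal (by positivity), smul_eq_mul, Measure.real]

theorem integral_abs_le_mul_rpow_of_tail (hf : Integrable f μ) {A K₁ K₂ β₀ : ℝ} (hA : 0 ≤ A)
    (hβ₀ : 0 < β₀) (hsup : ∀ᵐ x ∂μ, |f x| ≤ K₁ * A)
    (htail : ∀ R, 0 < R → ∫ x in {x | R ≤ ‖x‖}, |f x| ∂μ ≤ K₂ * R ^ (-β₀)) :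
    ∫ x, |f x| ∂μ ≤
      (μ.real (Metric.ball 0 1) * K₁ + K₂) * A ^ (β₀ / (finrank ℝ V + β₀)) := by
  set d := finrank ℝ V
  have hd : (d : ℝ) + β₀ ≠ 0 := by positivity
  rcases hA.eq_or_lt with rfl | hA
  · have hzero : ∫ x, |f x| ∂μ = 0 := integral_eq_zero_of_ae <| by
      filter_upwards [hsup] with x hx
      exact le_antisymm (by simpa using hx) (abs_nonneg _)
    rw [hzero, Real.zero_rpow (div_ne_zero hβ₀.ne' hd), mul_zero]
  set R := A ^ (-1 / (d + β₀)) with hR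
  have hR0 : 0 < R := by positivity
  have hcompl : {x : V | R ≤ ‖x‖}ᶜ = Metric.ball 0 R := by
    ext x
    simp
  have hball : ∫ x in Metric.ball 0 R, |f x| ∂μ ≤
      μ.real (Metric.ball 0 1) * K₁ * A ^ (β₀ / (d + β₀)) := by
    calc ∫ x in Metric.ball 0 R, |f x| ∂μ
        ≤ R ^ d * μ.real (Metric.ball 0 1) * (K₁ * A) := setIntegral_ball_abs_le μ hf hR0 hsup
      _ = μ.real (Metric.ball 0 1) * K₁ * (A ^ (-1 / (d + β₀) * d) * A ^ (1 : ℝ)) := by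
          rw [hR, Real.rpow_mul hA.le, Real.rpow_natCast, Real.rpow_one]
          ring
      _ = μ.real (Metric.ball 0 1) * K₁ * A ^ (β₀ / (d + β₀)) := by
          rw [← Real.rpow_add hA]
          congr 2
          field_simp
          ring
  have hfar : ∫ x in {x | R ≤ ‖x‖}, |f x| ∂μ ≤ K₂ * A ^ (β₀ / (d + β₀)) := by
    refine (htail R hR0).trans_eq ?_
    rw [hR, ← Real.rpow_mul hA.le]
    ring_nf
  calc ∫ x, |f x| ∂μ
      = ∫ x in {x | R ≤ ‖x‖}, |f x| ∂μ + ∫ x in Metric.ball 0 R, |f x| ∂μ := by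
        rw [← hcompl, integral_add_compl (measurableSet_le measurable_const measurable_norm) hf.abs]
    _ ≤ (μ.real (Metric.ball 0 1) * K₁ + K₂) * A ^ (β₀ / (d + β₀)) := by linarith

theorem le_mul_rpow_mul_of_le_two {a A a₀ D γ s : ℝ} (ha : a ≤ 2) (hA : 0 ≤ A) (ha₀ : 0 < a₀)
    (ha₀1 : a₀ ≤ 1) (hD : 0 ≤ D) (hγ : γ ∈ Set.Icc 0 1) (hs : s ∈ Set.Icc 0 1)
    (h : A < a₀ → a ≤ D * A ^ γ) : a ≤ (D + 2 / a₀) * A ^ (s * γ) := by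
  have hsγ : 0 ≤ s * γ := mul_nonneg hs.1 hγ.1
  rw [add_mul]
  rcases lt_or_ge A a₀ with hlt | hge
  · have hpow : A ^ γ ≤ A ^ (s * γ) :=
      Real.rpow_le_rpow_of_exponent_ge' hA (hlt.le.trans ha₀1) hsγ
        (mul_le_of_le_one_left hγ.1 hs.2)
    calc a ≤ D * A ^ (s * γ) := (h hlt).trans (mul_le_mul_of_nonneg_left hpow hD)
      _ ≤ D * A ^ (s * γ) + 2 / a₀ * A ^ (s * γ) := le_add_of_nonneg_right (by positivity)
  · have hpow : a₀ ≤ A ^ (s * γ) :=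
      (Real.self_le_rpow_of_le_one ha₀.le ha₀1 (mul_le_one₀ hs.2 hγ.1 hγ.2)).trans
        (Real.rpow_le_rpow ha₀.le hge hsγ)
    calc a ≤ 2 / a₀ * a₀ := ha.trans_eq (div_mul_cancel₀ _ ha₀.ne').symm
      _ ≤ 2 / a₀ * A ^ (s * γ) := by gcongr
      _ ≤ D * A ^ (s * γ) + 2 / a₀ * A ^ (s * γ) := le_add_of_nonneg_left (by positivity)

end Interpolation

section Perturbation

open Module (finrank)

theorem norm_exp_neg_mul_sub_le {z w : ℂ} (hz : 0 ≤ z.re) {c r m θ : ℝ} (hc : 0 ≤ c) (hr : 0 ≤ r)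
    (hzc : ‖z‖ ≤ c * r ^ m) (hθ : θ ∈ Set.Icc 0 1) :
    ‖Complex.exp (-z) * w - w‖ ≤ 2 * c ^ θ * (r ^ (m * θ) * ‖w‖) := by
  have hpow : ‖z‖ ^ θ ≤ c ^ θ * r ^ (m * θ) := by
    rw [Real.rpow_mul hr, ← Real.mul_rpow hc (by positivity)]
    exact Real.rpow_le_rpow (norm_nonneg z) hzc hθ.1
  calc ‖Complex.exp (-z) * w - w‖ = ‖1 - Complex.exp (-z)‖ * ‖w‖ := by
        rw [← norm_mul, norm_sub_rev]
        ring_nf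
    _ ≤ 2 * ‖z‖ ^ θ * ‖w‖ := by
        gcongr
        exact norm_one_sub_exp_neg_le_two_mul_rpow hz hθ
    _ ≤ 2 * (c ^ θ * r ^ (m * θ)) * ‖w‖ := by gcongr
    _ = 2 * c ^ θ * (r ^ (m * θ) * ‖w‖) := by ring

variable {V : Type*} [NormedAddCommGroup V] [InnerProductSpace ℝ V] [FiniteDimensional ℝ V]
  [MeasurableSpace V] [BorelSpace V]

theorem IsLebesgueDensity.integral_abs_sub_le_mul_rpow {μ ν : Measure V} [IsFiniteMeasure μ]
    [IsFiniteMeasure ν] {f g : V → ℝ} (hf : IsLebesgueDensity μ f) (hg : IsLebesgueDensity ν g)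
    (hμ : Integrable (charFun μ)) (hν : Integrable (charFun ν)) {A K K₁ K₂ β₀ : ℝ} (hA : 0 ≤ A)
    (hβ₀ : 0 < β₀) (hsub : ∫ ξ, ‖charFun μ ξ - charFun ν ξ‖ ≤ K * A)
    (hμ_tail : ∀ R, 0 < R → μ.real {x | R ≤ ‖x‖} ≤ K₁ * R ^ (-β₀))
    (hν_tail : ∀ R, 0 < R → ν.real {x | R ≤ ‖x‖} ≤ K₂ * R ^ (-β₀)) :
    ∫ x, |f x - g x| ≤ (volume.real (Metric.ball (0 : V) 1) * K + (K₁ + K₂)) *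
      A ^ (β₀ / (finrank ℝ V + β₀)) := by
  refine integral_abs_le_mul_rpow_of_tail volume (hf.integrable.sub hg.integrable) hA hβ₀ ?_
    fun R hR => ?_
  · filter_upwards [ae_abs_sub_le hμ hν hf hg] with x hx
    exact hx.trans hsub
  · rw [add_mul]
    exact (setIntegral_abs_sub_le hf hg (measurableSet_le measurable_const measurable_norm)).trans
      (add_le_add (hμ_tail R hR) (hν_tail R hR))

end Perturbation

section Regularity

open scoped RealInnerProductSpace
open Module (finrank)

theorem lt_one_of_rpow_div_rpow_lt {δ θ t S p q : ℝ} (hθ : 0 ≤ θ) (ht : 0 < t) (htS : t ≤ S)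
    (hS : 1 ≤ S) (hp : 0 ≤ p) (hpq : p ≤ q) (h : δ ^ θ / t ^ p < (S ^ q)⁻¹) : δ < 1 := by
  by_contra! hδ
  refine h.not_ge ?_
  calc (S ^ q)⁻¹ ≤ (t ^ p)⁻¹ := by
        gcongr
        exact (Real.rpow_le_rpow ht.le htS hp).trans (Real.rpow_le_rpow_of_exponent_le hS hpq)
    _ = 1 / t ^ p := (one_div _).symm
    _ ≤ δ ^ θ / t ^ p := by
        gcongr
        exact Real.one_le_rpow hδ hθ

theorem measureReal_map_add_le {E : Type*} [NormedAddCommGroup E] [MeasurableSpace E]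
    [BorelSpace E] {μ : Measure E} [IsProbabilityMeasure μ] {K β₀ : ℝ} (hK : 1 ≤ K)
    (hβ₀ : 0 ≤ β₀) (h_tail : ∀ R, 0 < R → μ.real {x | R ≤ ‖x‖} ≤ K * R ^ (-β₀)) {h : E}
    (hh : ‖h‖ ≤ 1) {R : ℝ} (hR : 0 < R) :
    (μ.map (· + h)).real {x | R ≤ ‖x‖} ≤ K * 2 ^ β₀ * R ^ (-β₀) := by
  have hscale : (2 : ℝ) ^ β₀ * R ^ (-β₀) = (R / 2) ^ (-β₀) := by
    rw [Real.div_rpow hR.le two_pos.le, Real.rpow_neg two_pos.le, div_inv_eq_mul, mul_comm]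
  rw [mul_assoc, hscale]
  rcases le_total (R / 2) 1 with hR2 | hR2
  · have := Measure.isProbabilityMeasure_map (μ := μ) (measurable_add_const h).aemeasurable
    calc (μ.map (· + h)).real {x | R ≤ ‖x‖} ≤ 1 := measureReal_le_one
      _ ≤ (R / 2) ^ (-β₀) :=
          Real.one_le_rpow_of_pos_of_le_one_of_nonpos (by positivity) hR2 (neg_nonpos.2 hβ₀)
      _ ≤ K * (R / 2) ^ (-β₀) := le_mul_of_one_le_left (by positivity) hK
  · rw [map_measureReal_apply (measurable_add_const h)
      (measurableSet_le measurable_const measurable_norm)]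
    refine (measureReal_mono fun x hx => ?_).trans (h_tail (R / 2) (by positivity))
    have hx' : R ≤ ‖x + h‖ := hx
    change R / 2 ≤ ‖x‖
    linarith [norm_add_le x h]

variable {V : Type*} [NormedAddCommGroup V] [InnerProductSpace ℝ V] [MeasurableSpace V]

/-- `ν` arises from `μ` by multiplying the characteristic function by `exp (-z)`, where `z` is a
function of growth order `m` with nonnegative real part. Translates and later times both fit this
pattern, with `m = 1` and `m = 2`. -/
def IsExpPerturbation (μ ν : Measure V) (c m : ℝ) : Prop :=
  ∀ ξ, ∃ z : ℂ, 0 ≤ z.re ∧ ‖z‖ ≤ c * (1 + ‖ξ‖) ^ m ∧ charFun ν ξ = Complex.exp (-z) * charFun μ ξ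

namespace IsExpPerturbation

variable {μ ν : Measure V} {c m : ℝ}

theorem norm_charFun_le (h : IsExpPerturbation μ ν c m) (ξ : V) :
    ‖charFun ν ξ‖ ≤ ‖charFun μ ξ‖ := by
  obtain ⟨z, hz, -, hν⟩ := h ξ
  rw [hν, norm_mul, Complex.norm_exp]
  exact mul_le_of_le_one_left (norm_nonneg _) (Real.exp_le_one_iff.2 (by simpa using hz))

variable [FiniteDimensional ℝ V] [BorelSpace V]

theorem integrable_charFun [IsFiniteMeasure ν] (h : IsExpPerturbation μ ν c m)
    (hμ : Integrable (charFun μ)) : Integrable (charFun ν) :=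
  hμ.mono continuous_charFun.aestronglyMeasurable (.of_forall h.norm_charFun_le)

theorem integral_norm_charFun_sub_le {M δ θ : ℝ} (h : IsExpPerturbation μ ν (M * δ) m)
    (hM : 1 ≤ M) (hδ : 0 ≤ δ) (hθ : θ ∈ Set.Icc 0 1)
    (hint : Integrable fun ξ => (1 + ‖ξ‖) ^ (m * θ) * ‖charFun μ ξ‖) :
    ∫ ξ, ‖charFun ν ξ - charFun μ ξ‖ ≤
      2 * M * δ ^ θ * ∫ ξ, (1 + ‖ξ‖) ^ (m * θ) * ‖charFun μ ξ‖ := by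
  have hpow : (M * δ) ^ θ ≤ M * δ ^ θ := by
    rw [Real.mul_rpow (by positivity) hδ]
    gcongr
    exact Real.rpow_le_self_of_one_le hM hθ.2
  rw [← integral_const_mul]
  refine integral_mono_of_nonneg (.of_forall fun ξ => norm_nonneg _) (hint.const_mul _)
    (.of_forall fun ξ => ?_)
  obtain ⟨z, hz, hzc, hν⟩ := h ξ
  calc ‖charFun ν ξ - charFun μ ξ‖
      ≤ 2 * (M * δ) ^ θ * ((1 + ‖ξ‖) ^ (m * θ) * ‖charFun μ ξ‖) := by
        rw [hν]
        exact norm_exp_neg_mul_sub_le hz (by positivity) (by positivity) hzc hθ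
    _ ≤ 2 * (M * δ ^ θ) * ((1 + ‖ξ‖) ^ (m * θ) * ‖charFun μ ξ‖) := by gcongr
    _ = 2 * M * δ ^ θ * ((1 + ‖ξ‖) ^ (m * θ) * ‖charFun μ ξ‖) := by ring

end IsExpPerturbation

theorem isExpPerturbation_map_add_const [BorelSpace V] (μ : Measure V) (h : V) :
    IsExpPerturbation μ (μ.map (· + -h)) ‖h‖ 1 := by
  refine fun ξ => ⟨⟪h, ξ⟫ * Complex.I, by simp, ?_, ?_⟩
  · rw [norm_mul, Complex.norm_real, Complex.norm_I, mul_one, Real.rpow_one]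
    exact (norm_inner_le_norm h ξ).trans (by gcongr; linarith)
  · rw [charFun_map_add_const, inner_neg_left, mul_comm]
    push_cast
    ring_nf

namespace HasCharExponent

variable {μ : ℝ≥0 → Measure V} {Ψ : V → ℂ}

theorem isExpPerturbation_add (hΨ : HasCharExponent μ Ψ) {M : ℝ}
    (hM : ∀ ξ, ‖Ψ ξ‖ ≤ M * (1 + ‖ξ‖) ^ 2) (t ε : ℝ≥0) :
    IsExpPerturbation (μ t) (μ (t + ε)) (M * ε) 2 := by
  refine fun ξ => ⟨ε * Ψ ξ, ?_, ?_, ?_⟩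
  · simpa using mul_nonneg ε.coe_nonneg (hΨ.re_nonneg ξ)
  · rw [norm_mul, Complex.norm_real, Real.norm_of_nonneg ε.coe_nonneg, Real.rpow_two]
    calc ε * ‖Ψ ξ‖ ≤ ε * (M * (1 + ‖ξ‖) ^ 2) := by gcongr; exact hM ξ
      _ = M * ε * (1 + ‖ξ‖) ^ 2 := by ring
  · rw [hΨ.charFun_eq, hΨ.charFun_eq, ← Complex.exp_add, NNReal.coe_add]
    push_cast
    ring_nf

variable [FiniteDimensional ℝ V] [BorelSpace V]

theorem integrable_charFun (hΨ : HasCharExponent μ Ψ) {β : ℝ} (hβ : 0 < β)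
    (hinf : ∀ b < β, ∀ᶠ ξ in Bornology.cobounded V, ‖ξ‖ ^ b ≤ (Ψ ξ).re) {t : ℝ≥0} (ht : 0 < t) :
    Integrable (charFun (μ t)) := by
  have := hΨ.isProbabilityMeasure t
  obtain ⟨_, -, h⟩ :=
    hΨ.exists_integral_one_add_norm_rpow_mul_norm_charFun_le hβ hinf le_rfl one_pos t
  have hnorm := (h 0 ⟨le_rfl, le_rfl⟩ t ht le_rfl).1
  simp only [Real.rpow_zero, one_mul] at hnorm
  exact (integrable_norm_iff continuous_charFun.aestronglyMeasurable).1 hnorm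

theorem exists_integral_abs_sub_le (hΨ : HasCharExponent μ Ψ) {β : ℝ} (hβ : 0 < β)
    (hinf : ∀ b < β, ∀ᶠ ξ in Bornology.cobounded V, ‖ξ‖ ^ b ≤ (Ψ ξ).re) {β₀ : ℝ} (hβ₀ : 0 < β₀)
    {κ : ℝ} (hκ : 0 < κ) {m M K₁ K₂ : ℝ} (hm : 0 ≤ m) (hM : 1 ≤ M) (hK₁ : 0 ≤ K₁) (hK₂ : 0 ≤ K₂)
    {T : ℝ≥0} (hμ_tail : ∀ t ≤ T, ∀ R, 0 < R → (μ t).real {x | R ≤ ‖x‖} ≤ K₁ * R ^ (-β₀)) :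
    ∃ C, 0 < C ∧ ∀ t, 0 < t → t ≤ T → ∀ δ : ℝ, 0 ≤ δ → ∀ ν : Measure V, IsProbabilityMeasure ν →
      IsExpPerturbation (μ t) ν (M * δ) m →
      (δ < 1 → ∀ R, 0 < R → ν.real {x | R ≤ ‖x‖} ≤ K₂ * R ^ (-β₀)) →
      ∀ f g, IsLebesgueDensity (μ t) f → IsLebesgueDensity ν g →
      ∀ θ ∈ Set.Icc 0 1, ∀ s ∈ Set.Icc 0 1,
        ∫ x, |g x - f x| ≤ C * (δ ^ θ / t ^ ((m * θ + finrank ℝ V) / β + κ)) ^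
          (s * β₀ / (finrank ℝ V + β₀)) := by
  set d : ℝ := (finrank ℝ V : ℝ)
  obtain ⟨J, hJ, hmoment⟩ :=
    hΨ.exists_integral_one_add_norm_rpow_mul_norm_charFun_le hβ hinf hm hκ T
  set S : ℝ := max T 1
  set a₀ := (S ^ ((m + d) / β + κ))⁻¹
  set D := volume.real (Metric.ball (0 : V) 1) * (2 * M * J) + (K₂ + K₁)
  have hS1 : 1 ≤ S := le_max_right _ _
  refine ⟨D + 2 / a₀, by positivity, fun t ht htT δ hδ ν _ hν hν_tail f g hf hg θ hθ s hs => ?_⟩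
  have := hΨ.isProbabilityMeasure t
  have htS : (t : ℝ) ≤ S := (NNReal.coe_le_coe.2 htT).trans (le_max_left _ _)
  have hmθ : m * θ ∈ Set.Icc 0 m := ⟨mul_nonneg hm hθ.1, mul_le_of_le_one_right hm hθ.2⟩
  have hd0 : 0 ≤ d := Nat.cast_nonneg _
  set e := (m * θ + d) / β + κ
  have he : 0 ≤ e ∧ e ≤ (m + d) / β + κ :=
    ⟨by have := hmθ.1; positivity, by unfold e; gcongr; exact hmθ.2⟩
  set A := δ ^ θ / t ^ e
  obtain ⟨hint, hmoment_le⟩ := hmoment _ hmθ t ht htT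
  have hμ_int := hΨ.integrable_charFun hβ hinf ht
  have hsub : ∫ ξ, ‖charFun ν ξ - charFun (μ t) ξ‖ ≤ 2 * M * J * A := by
    calc ∫ ξ, ‖charFun ν ξ - charFun (μ t) ξ‖ ≤ 2 * M * δ ^ θ * (J / t ^ e) :=
          (hν.integral_norm_charFun_sub_le hM hδ hθ hint).trans (by gcongr)
      _ = 2 * M * J * A := by ring
  have hsmall (hA : A < a₀) : ∫ x, |g x - f x| ≤ D * A ^ (β₀ / (d + β₀)) :=
    hg.integral_abs_sub_le_mul_rpow hf (hν.integrable_charFun hμ_int) hμ_int (by positivity) hβ₀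
      hsub (hν_tail (lt_one_of_rpow_div_rpow_lt hθ.1 ht htS hS1 he.1 he.2 hA)) (hμ_tail t htT)
  have hγ : β₀ / (d + β₀) ∈ Set.Icc 0 1 :=
    ⟨by positivity, (div_le_one (by positivity)).2 (le_add_of_nonneg_left hd0)⟩
  rw [mul_div_assoc]
  exact le_mul_rpow_mul_of_le_two (hg.integral_abs_sub_le_two hf) (by positivity) (by positivity)
    (inv_le_one_of_one_le₀ (Real.one_le_rpow hS1 (he.1.trans he.2))) (by positivity) hγ hs hsmall

theorem exists_integral_abs_comp_add_sub_le (hΨ : HasCharExponent μ Ψ) {β : ℝ} (hβ : 0 < β)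
    (hinf : ∀ b < β, ∀ᶠ ξ in Bornology.cobounded V, ‖ξ‖ ^ b ≤ (Ψ ξ).re) {β₀ : ℝ} (hβ₀ : 0 < β₀)
    (hzero : IntegrableOn (fun ξ => ‖Ψ ξ‖ / ‖ξ‖ ^ ((finrank ℝ V : ℝ) + β₀))
      (Metric.closedBall (0 : V) 1)) {κ : ℝ} (hκ : 0 < κ) (T : ℝ≥0) :
    ∃ C, 0 < C ∧ ∀ t, 0 < t → t ≤ T → ∀ f, IsLebesgueDensity (μ t) f → ∀ h : V,
      ∀ θ ∈ Set.Icc 0 1, ∀ s ∈ Set.Icc 0 1,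
        ∫ x, |f (x + h) - f x| ≤ C * (‖h‖ ^ θ / t ^ ((θ + finrank ℝ V) / β + κ)) ^
          (s * β₀ / (finrank ℝ V + β₀)) := by
  obtain ⟨K, hK, h_tail⟩ := hΨ.exists_measureReal_le_norm_le hβ₀ hzero T
  obtain ⟨C, hC, hbound⟩ := hΨ.exists_integral_abs_sub_le hβ hinf hβ₀ hκ zero_le_one le_rfl hK
    (by positivity : 0 ≤ (K + 1) * 2 ^ β₀) h_tail
  refine ⟨C, hC, fun t ht htT f hf h θ hθ s hs => ?_⟩
  have := hΨ.isProbabilityMeasure t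
  have hν_tail (hh : ‖h‖ < 1) (R : ℝ) (hR : 0 < R) :=
    measureReal_map_add_le (K := K + 1) (by linarith) hβ₀.le
      (fun R hR => (h_tail t htT R hR).trans (by gcongr; linarith))
      (by rw [norm_neg]; exact hh.le : ‖-h‖ ≤ 1) hR
  have hpert : IsExpPerturbation (μ t) ((μ t).map (· + -h)) (1 * ‖h‖) 1 := by
    rw [one_mul]
    exact isExpPerturbation_map_add_const _ _
  have hbound_h := hbound t ht htT ‖h‖ (norm_nonneg h) _
    (Measure.isProbabilityMeasure_map (measurable_add_const _).aemeasurable) hpert hν_tail f _ hf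
    (hf.comp_add_right h) θ hθ s hs
  rwa [one_mul] at hbound_h

theorem exists_integral_abs_add_sub_le (hΨ : HasCharExponent μ Ψ) {β : ℝ} (hβ : 0 < β)
    (hinf : ∀ b < β, ∀ᶠ ξ in Bornology.cobounded V, ‖ξ‖ ^ b ≤ (Ψ ξ).re) {β₀ : ℝ} (hβ₀ : 0 < β₀)
    (hzero : IntegrableOn (fun ξ => ‖Ψ ξ‖ / ‖ξ‖ ^ ((finrank ℝ V : ℝ) + β₀))
      (Metric.closedBall (0 : V) 1)) {κ : ℝ} (hκ : 0 < κ) (T : ℝ≥0) :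
    ∃ C, 0 < C ∧ ∀ t, 0 < t → t ≤ T → ∀ ε : ℝ≥0, ∀ f g, IsLebesgueDensity (μ t) f →
      IsLebesgueDensity (μ (t + ε)) g → ∀ θ ∈ Set.Icc 0 1, ∀ s ∈ Set.Icc 0 1,
        ∫ x, |g x - f x| ≤ C * (ε ^ θ / t ^ ((2 * θ + finrank ℝ V) / β + κ)) ^
          (s * β₀ / (finrank ℝ V + β₀)) := by
  obtain ⟨K, hK, h_tail⟩ := hΨ.exists_measureReal_le_norm_le hβ₀ hzero (T + 1)
  obtain ⟨M, hM, hquad⟩ := exists_norm_le_mul_one_add_norm_sq hΨ.continuous hΨ.norm_two_smul_le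
  obtain ⟨C, hC, hbound⟩ := hΨ.exists_integral_abs_sub_le hβ hinf hβ₀ hκ two_pos.le
    (le_add_of_nonneg_left hM : 1 ≤ M + 1) hK hK fun t ht => h_tail t (ht.trans le_self_add)
  have hquad' (ξ : V) : ‖Ψ ξ‖ ≤ (M + 1) * (1 + ‖ξ‖) ^ 2 :=
    (hquad ξ).trans (by gcongr; linarith)
  refine ⟨C, hC, fun t ht htT ε f g hf hg => ?_⟩
  exact hbound t ht htT ε ε.coe_nonneg _ (hΨ.isProbabilityMeasure _)
    (hΨ.isExpPerturbation_add hquad' t ε)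
    (fun hε => h_tail (t + ε) (add_le_add htT (by exact_mod_cast hε.le))) f g hf hg

end HasCharExponent

theorem lemma2p4_general {V : Type*} [NormedAddCommGroup V] [InnerProductSpace ℝ V]
    [FiniteDimensional ℝ V] [MeasurableSpace V] [BorelSpace V] {μ : ℝ≥0 → Measure V} {Ψ : V → ℂ}
    (hΨ : HasCharExponent μ Ψ) {β : ℝ} (hβ : 0 < β)
    (hinf : ∀ b < β, ∀ᶠ ξ in Bornology.cobounded V, ‖ξ‖ ^ b ≤ (Ψ ξ).re) {β₀ : ℝ} (hβ₀ : 0 < β₀)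
    (hzero : IntegrableOn (fun ξ => ‖Ψ ξ‖ / ‖ξ‖ ^ ((finrank ℝ V : ℝ) + β₀))
      (Metric.closedBall (0 : V) 1)) :
    (∃ p : ℝ≥0 → V → ℝ, ∀ t, 0 < t → IsLebesgueDensity (μ t) (p t)) ∧
    ∀ T : ℝ≥0, ∀ κ : ℝ, 0 < κ → ∃ C : ℝ, 0 < C ∧
      ∀ p : ℝ≥0 → V → ℝ, (∀ t, 0 < t → IsLebesgueDensity (μ t) (p t)) →
      ∀ θ ∈ Set.Icc (0 : ℝ) 1, ∀ t : ℝ≥0, 0 < t → t ≤ T →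
        (∀ τ ∈ Set.Icc (0 : ℝ) 1, ∀ h : V,
          ∫ x, |p t (x + h) - p t x| ≤
            C * (‖h‖ ^ θ / (t : ℝ) ^ ((θ + finrank ℝ V) / β + κ)) ^
              (τ * β₀ / (finrank ℝ V + β₀))) ∧
        (∀ ω ∈ Set.Icc (0 : ℝ) 1, ∀ ε : ℝ≥0,
          ∫ x, |p (t + ε) x - p t x| ≤
            C * ((ε : ℝ) ^ θ / (t : ℝ) ^ ((2 * θ + finrank ℝ V) / β + κ)) ^
              (ω * β₀ / (finrank ℝ V + β₀))) := by
  have := hΨ.isProbabilityMeasure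
  refine ⟨⟨_, fun t ht => .of_integrable_charFun (hΨ.integrable_charFun hβ hinf ht)⟩,
    fun T κ hκ => ?_⟩
  obtain ⟨C₁, hC₁, hspace⟩ := hΨ.exists_integral_abs_comp_add_sub_le hβ hinf hβ₀ hzero hκ T
  obtain ⟨C₂, -, htime⟩ := hΨ.exists_integral_abs_add_sub_le hβ hinf hβ₀ hzero hκ T
  refine ⟨max C₁ C₂, lt_max_of_lt_left hC₁, fun p hp θ hθ t ht htT =>
    ⟨fun τ hτ h => ?_, fun ω hω ε => ?_⟩⟩
  · exact (hspace t ht htT _ (hp t ht) h θ hθ τ hτ).trans (by gcongr; exact le_max_left _ _)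
  · exact (htime t ht htT ε _ _ (hp t ht) (hp _ (add_pos_of_pos_of_nonneg ht ε.2)) θ hθ ω hω).trans
      (by gcongr; exact le_max_right _ _)

end Regularity

theorem lemma2p4 {Ω : Type*} [MeasurableSpace Ω] (P : Measure Ω) [IsProbabilityMeasure P]
    (n : ℕ) (hn : 1 ≤ n)
    (X : ℝ≥0 → Ω → EuclideanSpace ℝ (Fin n)) (hX : IsLevyProcess P X)
    (Ψ : EuclideanSpace ℝ (Fin n) → ℂ) (hΨ : IsCharExponent P X Ψ)
    (βinf : ℝ) (hβinf : βinf ∈ Set.Ioo (0 : ℝ) 2)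
    (hinf : lowerIndexAtInfinity Ψ = (βinf : EReal))
    (β₀ : ℝ) (hβ₀ : β₀ ∈ Set.Ioo (0 : ℝ) 1)
    (hzero : IntegrableOn (fun ξ => ‖Ψ ξ‖ / ‖ξ‖ ^ ((n : ℝ) + β₀))
      (Metric.closedBall (0 : EuclideanSpace ℝ (Fin n)) 1)) :
    (∃ p, IsTransitionDensity P X p) ∧
    ∀ T : ℝ, 0 < T → ∀ κ ∈ Set.Ioo (0 : ℝ) (β₀ / 2), ∃ C : ℝ, 0 < C ∧
      ∀ p, IsTransitionDensity P X p →
      ∀ θ ∈ Set.Ioo (0 : ℝ) 1, ∀ t : ℝ≥0, 0 < t → (t : ℝ) < T →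
        (∀ τ ∈ Set.Ioo (0 : ℝ) 1, ∀ h : EuclideanSpace ℝ (Fin n), ‖h‖ ≤ 1 →
          ∫ x, |p t (x + h) - p t x| ≤
            C * (‖h‖ ^ θ / (t : ℝ) ^ ((θ + n) / βinf + κ)) ^ (τ * β₀ / (n + β₀))) ∧
        (∀ ω ∈ Set.Ioo (0 : ℝ) 1, ∀ ε : ℝ≥0, 0 < ε →
          ∫ x, |p (t + ε) x - p t x| ≤
            C * ((ε : ℝ) ^ θ / (t : ℝ) ^ ((2 * θ + n) / βinf + κ)) ^ (ω * β₀ / (n + β₀))) := by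
  obtain ⟨⟨p, hp⟩, hbound⟩ := lemma2p4_general (hΨ.hasCharExponent hX.measurable) hβinf.1
    (fun b hb => eventually_rpow_le_re_of_lt_lowerIndexAtInfinity
      (by rw [hinf]; exact_mod_cast hb)) hβ₀.1 (by rwa [finrank_euclideanSpace_fin])
  simp only [finrank_euclideanSpace_fin] at hbound
  refine ⟨⟨p, fun t ht => ⟨(hp t ht).1, (hp t ht).2, (hp t ht).3⟩⟩, fun T hT κ hκ => ?_⟩
  obtain ⟨C, hC, hCbound⟩ := hbound ⟨T, hT.le⟩ κ hκ.1
  refine ⟨C, hC, fun q hq θ hθ t ht htT => ?_⟩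
  obtain ⟨hspace, htime⟩ := hCbound q (fun t ht => ⟨(hq t ht).1, (hq t ht).2.1, (hq t ht).2.2⟩) θ
    (Set.Ioo_subset_Icc_self hθ) t ht htT.le
  exact ⟨fun τ hτ h _ => hspace τ (Set.Ioo_subset_Icc_self hτ) h,
    fun ω hω ε _ => htime ω (Set.Ioo_subset_Icc_self hω) ε⟩
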